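/- Graphs here are finite multigraphs without loops (parallel edges are allowed); a graph without parallel edges is called simple. The maximum multiplicity of a graph $G$ is the largest number of edges joining two distinct vertices of $G$, and $G$ is decomposed into subgraphs if every edge of $G$ lies in exactly one of them. Let $G$ be a $k$-regular graph of even order $n\ge 96$ and with odd maximum multiplicity $r\ge 3$. Then the following statements hold. (a) If $k=rs\ge r(n/2+16)$ for some even integer $s$, then $G$ can be decomposed into $r-2$ perfect matchings, $(r+1)/2$ Hamilton cycles, one spanning $(s-1)$-regular simple graph, and $r-1$ spanning $(s-2)$-regular simple graphs. (b) If $k=rs\ge r(n/2+17)$ for some odd integer $s$, then $G$ can be decomposed into $2r-2$ perfect matchings, $(r+1)/2$ Hamilton cycles, one spanning $(s-2)$-regular simple graph, and $r-1$ spanning $(s-3)$-regular simple graphs. -/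

import Mathlib

namespace Graph

variable {α β : Type*}

/-- The degree of a vertex in a multigraph: the number of incident edges, a loop counting twice. -/
noncomputable def vertexDegree (G : Graph α β) (v : α) : ℕ∞ :=
  (G.incidenceSet v).encard + (G.loopSet v).encard

/-- Every vertex has degree `k`. -/
def IsRegularOfDegree (G : Graph α β) (k : ℕ) : Prop :=
  ∀ v ∈ G.vertexSet, G.vertexDegree v = k

/-- The largest number of edges joining two distinct vertices. -/
noncomputable def maxMultiplicity (G : Graph α β) : ℕ∞ :=
  ⨆ (x : α) (y : α) (_ : x ≠ y), {e : β | G.IsLink e x y}.encard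

/-- `C` is a cycle with distinct vertices `v 0, …, v (m-1)` and distinct edges `e 0, …, e (m-1)`,
where `e i` joins `v i` to `v (i + 1)` (indices modulo `m`). A pair of parallel edges is
a cycle of length two. -/
def IsCycle (C : Graph α β) : Prop :=
  ∃ m : ℕ, 1 ≤ m ∧ ∃ (v : ZMod m → α) (e : ZMod m → β),
    Function.Injective v ∧ Function.Injective e ∧
    Set.range v = C.vertexSet ∧ Set.range e = C.edgeSet ∧
    ∀ i, C.IsLink (e i) (v i) (v (i + 1))

/-- `C` is a Hamilton cycle of `G`. -/
def IsHamiltonCycleOf (C G : Graph α β) : Prop :=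
  C.IsSpanningSubgraph G ∧ C.IsCycle

/-- `P` is (the spanning subgraph of `G` formed by) a perfect matching of `G`: every vertex is
in exactly one edge of `P`. -/
def IsPerfectMatchingOf (P G : Graph α β) : Prop :=
  P.IsSpanningSubgraph G ∧ P.IsRegularOfDegree 1

/-- `H` is a spanning subgraph of `G` which is a `d`-regular simple graph. -/
def IsSpanningSimpleRegularOf (H G : Graph α β) (d : ℕ) : Prop :=
  H.IsSpanningSubgraph G ∧ H.Simple ∧ H.IsRegularOfDegree d

/-- The subgraphs `H i` of `G` decompose `G`: every edge of `G` is in exactly one of them. -/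
def IsDecomposition {ι : Type*} (G : Graph α β) (H : ι → Graph α β) : Prop :=
  (∀ i, H i ≤ G) ∧ ∀ e ∈ G.edgeSet, ∃! i, e ∈ (H i).edgeSet

/-- `G` can be decomposed into `p` perfect matchings, `h` Hamilton cycles, one spanning
`d₁`-regular simple graph and `q` spanning `d₂`-regular simple graphs. -/
def DecomposesInto (G : Graph α β) (p h d₁ q d₂ : ℕ) : Prop :=
  ∃ (P : Fin p → Graph α β) (C : Fin h → Graph α β) (S : Graph α β) (T : Fin q → Graph α β),
    (∀ i, (P i).IsPerfectMatchingOf G) ∧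
    (∀ i, (C i).IsHamiltonCycleOf G) ∧
    S.IsSpanningSimpleRegularOf G d₁ ∧
    (∀ i, (T i).IsSpanningSimpleRegularOf G d₂) ∧
    G.IsDecomposition (Sum.elim P (Sum.elim C (Sum.elim (fun _ : Unit => S) T)))

end Graph

/-! Only the multiplicity matrix `μ` of the graph matters, since parallel edges can be distributed
arbitrarily once the number of each kind is known.

The basic device is a balanced zero-one matrix `y`, with all row and column sums `d + 1`. The
multigraph `y + yᵀ` has multiplicity at most two and splits into a Hamilton cycle and two
`d`-regular simple graphs (`exists_hamilton_split`). A spanning forest of the one-way arcs is set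
aside, a Hamilton cycle is found outside it by Pósa's condition, and the forest keeps the edges of
multiplicity one connected in the remainder. An Euler tour of these edges has even length, and
taking every second edge halves all degrees.

If the multiplicity bound is an even number `2 * t`, a balanced orientation has entries at most `t`
and is a sum of `t` such matrices, because network flows can be rounded. This gives `t` Hamilton
cycles and `2 * t` simple graphs (`IsRegularMatrix.exists_hamilton_decomposition`).

For odd `r` the bound must first be lowered to `r - 1`. Orient `μ / r` fractionally with row and
column sums `s`, and round it to `y`. Pairs of multiplicity `r` appear twice in `y + yᵀ`, so a
Hamilton cycle `C` and one simple part `A` together use at least one of their edges. The sum `C + A`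
can exceed `μ` only at a pair of multiplicity one that is oriented both ways. A basic solution of
the orientation problem leaves at most `|V|` such pairs, and a Hamilton cycle can avoid them all
(`IsRegularMatrix.exists_hamilton_add_simple`).

Perfect matchings, obtained from Dirac's theorem, correct the degree before the even case is
applied. For the second statement, `r` further matchings replace `s` by `s - 1` at the start. -/

/-! ### Basic solutions of linear systems and integrality of network flows -/

section NetworkIntegrality

variable {I J : Type*} [Fintype I] [DecidableEq J]

/-- The net flow out of the node `j` when the arc `i` from `tail i` to `head i` carries `x i`. -/
noncomputable def netFlow (tail head : I → J) : (I → ℝ) →ₗ[ℝ] (J → ℝ) where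
  toFun x j := ∑ i, x i * ((if tail i = j then 1 else 0) - (if head i = j then 1 else 0))
  map_add' x y := by
    ext j; simp only [Pi.add_apply, ← Finset.sum_add_distrib]
    exact Finset.sum_congr rfl fun i _ => by ring
  map_smul' c x := by
    ext j; simp only [Pi.smul_apply, smul_eq_mul, RingHom.id_apply, Finset.mul_sum]
    exact Finset.sum_congr rfl fun i _ => by ring

theorem netFlow_apply (tail head : I → J) (x : I → ℝ) (j : J) :
    netFlow tail head x j =
      ∑ i, x i * ((if tail i = j then 1 else 0) - (if head i = j then 1 else 0)) := rfl

theorem sum_netFlow [Fintype J] (tail head : I → J) (x : I → ℝ) : ∑ j, netFlow tail head x j = 0 := by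
  simp only [netFlow_apply]
  rw [Finset.sum_comm]
  refine Finset.sum_eq_zero fun i _ => ?_
  rw [← Finset.mul_sum, Finset.sum_sub_distrib]
  simp

/-- A linear system with box constraints has a solution at which no kernel vector is supported on
the coordinates strictly inside the box. -/
theorem exists_basic_solution {E : Type*} [AddCommGroup E] [Module ℝ E]
    (A : (I → ℝ) →ₗ[ℝ] E) (l u x₀ : I → ℝ) (hl : l ≤ x₀) (hu : x₀ ≤ u) :
    ∃ x, l ≤ x ∧ x ≤ u ∧ A x = A x₀ ∧
      ∀ z, A z = 0 → (∀ i, z i ≠ 0 → l i < x i ∧ x i < u i) → z = 0 := by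
  set S : Set (I → ℝ) := {x | x ∈ Set.Icc l u ∧ A (x - x₀) = 0} with hS
  have hcl : IsClosed {x : I → ℝ | A (x - x₀) = 0} := by
    have : IsClosed ((LinearMap.ker A : Submodule ℝ (I → ℝ)) : Set (I → ℝ)) :=
      Submodule.closed_of_finiteDimensional _
    exact this.preimage (f := fun x : I → ℝ => x - x₀) (by fun_prop)
  have hcomp : IsCompact S := (isCompact_Icc (a := l) (b := u)).inter_right hcl
  -- An extreme point works: a kernel vector supported on slack coordinates could be added and
  -- subtracted in a small multiple, placing the point inside a segment.
  obtain ⟨x, hx⟩ := hcomp.extremePoints_nonempty ⟨x₀, ⟨hl, hu⟩, by simp⟩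
  refine ⟨x, hx.1.1.1, hx.1.1.2, by have := hx.1.2; rwa [map_sub, sub_eq_zero] at this, ?_⟩
  intro z hz hsupp
  by_contra hne
  obtain ⟨i₀, hi₀⟩ : ∃ i, z i ≠ 0 := by
    by_contra! h
    exact hne (funext h)
  obtain ⟨ε, hε, hbox⟩ : ∃ ε : ℝ, 0 < ε ∧ ∀ i, z i ≠ 0 →
      l i ≤ x i - ε * |z i| ∧ x i + ε * |z i| ≤ u i := by
    have hev : ∀ᶠ ε in nhdsWithin (0 : ℝ) (Set.Ioi 0), ∀ i, z i ≠ 0 →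
        l i ≤ x i - ε * |z i| ∧ x i + ε * |z i| ≤ u i := by
      rw [Filter.eventually_all]
      intro i
      by_cases hi : z i = 0
      · simp [hi]
      obtain ⟨h1, h2⟩ := hsupp i hi
      have t1 : Filter.Tendsto (fun ε : ℝ => x i - ε * |z i|) (nhdsWithin 0 (Set.Ioi 0))
          (nhds (x i - 0 * |z i|)) :=
        (Continuous.tendsto (by fun_prop) _).mono_left nhdsWithin_le_nhds
      have t2 : Filter.Tendsto (fun ε : ℝ => x i + ε * |z i|) (nhdsWithin 0 (Set.Ioi 0))
          (nhds (x i + 0 * |z i|)) :=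
        (Continuous.tendsto (by fun_prop) _).mono_left nhdsWithin_le_nhds
      filter_upwards [t1.eventually (lt_mem_nhds (by simpa using h1)),
        t2.eventually (gt_mem_nhds (by simpa using h2))] with ε a b _
      exact ⟨a.le, b.le⟩
    obtain ⟨ε, h1, h2⟩ := (hev.and self_mem_nhdsWithin).exists
    exact ⟨ε, h2, h1⟩
  have hmem : ∀ c : ℝ, |c| ≤ ε → x + c • z ∈ S := by
    intro c hc
    have key : ∀ i, l i ≤ x i + c * z i ∧ x i + c * z i ≤ u i := by
      intro i
      by_cases hi : z i = 0
      · simpa [hi] using ⟨hx.1.1.1 i, hx.1.1.2 i⟩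
      · have h1 : |c * z i| ≤ ε * |z i| := by
          rw [abs_mul]; exact mul_le_mul_of_nonneg_right hc (abs_nonneg _)
        have := abs_le.1 h1
        have := hbox i hi
        constructor <;> linarith
    refine ⟨⟨fun i => (key i).1, fun i => (key i).2⟩, ?_⟩
    have h0 := hx.1.2
    rw [map_sub, sub_eq_zero] at h0
    simp [map_add, map_sub, hz, h0]
  have h1 := hmem ε (abs_of_pos hε).le
  have h2 := hmem (-ε) (by rw [abs_neg, abs_of_pos hε])
  have hopen : x ∈ openSegment ℝ (x + ε • z) (x + (-ε) • z) := by
    refine ⟨1/2, 1/2, by norm_num, by norm_num, by norm_num, ?_⟩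
    ext i; simp; ring
  have := hx.2 h1 h2 hopen
  have h3 := congrFun this i₀
  simp at h3
  rcases h3 with h3 | h3
  · exact hε.ne' h3
  · exact hi₀ h3

/-- A linear map from a function space to a space of smaller dimension kills a nonzero
function supported in a given set. -/
theorem exists_kernel_supported {E : Type*} [AddCommGroup E] [Module ℝ E]
    [FiniteDimensional ℝ E] (A : (I → ℝ) →ₗ[ℝ] E) (N : Finset I)
    (h : Module.finrank ℝ E < N.card) :
    ∃ z, z ≠ 0 ∧ A z = 0 ∧ ∀ i, z i ≠ 0 → i ∈ N := by
  classical
  let ext : (N → ℝ) →ₗ[ℝ] (I → ℝ) :=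
    { toFun := fun w i => if hi : i ∈ N then w ⟨i, hi⟩ else 0
      map_add' := fun a b => by ext i; by_cases hi : i ∈ N <;> simp [hi]
      map_smul' := fun a b => by ext i; by_cases hi : i ∈ N <;> simp [hi] }
  have hker : LinearMap.ker (A ∘ₗ ext) ≠ ⊥ := by
    apply LinearMap.ker_ne_bot_of_finrank_lt
    simpa using h
  obtain ⟨w, hw, hw0⟩ := (Submodule.ne_bot_iff _).1 hker
  refine ⟨ext w, ?_, hw, ?_⟩
  · intro h0
    apply hw0
    ext i
    have := congrFun h0 i
    simpa [ext] using this
  · intro i hi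
    by_contra hn
    exact hi (by simp [ext, hn])

/-- Integrality of network flows: a real flow with integral net flows can be rounded. -/
theorem exists_integral_flow [Fintype J] (tail head : I → J) (x₀ : I → ℝ)
    (hint : ∀ j, ∃ m : ℤ, netFlow tail head x₀ j = m) :
    ∃ x : I → ℤ, (∀ i, ⌊x₀ i⌋ ≤ x i ∧ x i ≤ ⌈x₀ i⌉) ∧
      netFlow tail head (fun i => (x i : ℝ)) = netFlow tail head x₀ := by
  classical
  obtain ⟨x, hl, hu, hA, hker⟩ := exists_basic_solution (netFlow tail head)
    (fun i => (⌊x₀ i⌋ : ℝ)) (fun i => (⌈x₀ i⌉ : ℝ)) x₀ (fun i => Int.floor_le _)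
    (fun i => Int.le_ceil _)
  set N : Finset I := Finset.univ.filter fun i => ∀ m : ℤ, x i ≠ m with hN
  have hNint : ∀ i, i ∉ N → ∃ m : ℤ, x i = m := by
    intro i hi; simpa [hN] using hi
  have hstrict : ∀ i ∈ N, (⌊x₀ i⌋ : ℝ) < x i ∧ x i < (⌈x₀ i⌉ : ℝ) := by
    intro i hi
    have : ∀ m : ℤ, x i ≠ m := by simpa [hN] using hi
    exact ⟨lt_of_le_of_ne (hl i) (this _).symm, lt_of_le_of_ne (hu i) (this _)⟩
  have hker' : ∀ z, netFlow tail head z = 0 → (∀ i, z i ≠ 0 → i ∈ N) → z = 0 :=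
    fun z hz hs => hker z hz fun i hi => hstrict i (hs i hi)
  have hempty : N = ∅ := by
    by_contra hne
    obtain ⟨i₁, hi₁⟩ := Finset.nonempty_iff_ne_empty.2 hne
    -- A unit flow on a loop has zero net flow, so a fractional loop would already contradict
    -- basicness.
    have hloop : ∀ i ∈ N, tail i ≠ head i := by
      intro i hi hth
      have : (Pi.single i (1 : ℝ) : I → ℝ) = 0 := by
        apply hker'
        · ext j
          rw [netFlow_apply]
          refine Finset.sum_eq_zero fun i' _ => ?_
          by_cases h : i' = i
          · subst h; simp [hth]
          · simp [h]
        · intro i' h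
          by_cases h' : i' = i
          · exact h' ▸ hi
          · simp [h'] at h
      have := congrFun this i
      simp at this
    set JN : Finset J := N.image tail ∪ N.image head with hJN
    -- A node touched by a single fractional arc would have non-integral net flow. So every touched
    -- node meets at least two fractional arcs, while each arc has only two ends.
    have hcard : JN.card ≤ N.card := by
      have h2 : ∀ j ∈ JN, 2 ≤ (N.filter fun i => tail i = j ∨ head i = j).card := by
        intro j hj
        obtain ⟨i, hiN, hij⟩ : ∃ i ∈ N, tail i = j ∨ head i = j := by
          simp only [hJN, Finset.mem_union, Finset.mem_image] at hj
          rcases hj with ⟨i, hi, h⟩ | ⟨i, hi, h⟩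
          · exact ⟨i, hi, Or.inl h⟩
          · exact ⟨i, hi, Or.inr h⟩
        by_contra hlt
        have hone : (N.filter fun i => tail i = j ∨ head i = j) = {i} := by
          apply Finset.eq_singleton_iff_unique_mem.2
          refine ⟨by simp [hiN, hij], fun i' hi' => ?_⟩
          exact Finset.card_le_one.1 (by omega) _ hi' _ (by simp [hiN, hij])
        obtain ⟨m, hm⟩ := hint j
        have hx : netFlow tail head x j = m := by rw [hA, hm]
        rw [netFlow_apply, ← Finset.add_sum_erase _ _ (Finset.mem_univ i)] at hx
        have hrest : ∃ q : ℤ, ∑ i' ∈ Finset.univ.erase i, x i' *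
            (((if tail i' = j then 1 else 0) - (if head i' = j then 1 else 0) : ℝ)) = q := by
          have : ∀ i' : I, ∃ q : ℤ, i' ≠ i → x i' *
            (((if tail i' = j then 1 else 0) - (if head i' = j then 1 else 0) : ℝ)) = q := by
            intro i'
            by_cases hii : i' = i
            · exact ⟨0, fun h => absurd hii h⟩
            by_cases hi' : i' ∈ N
            · have : ¬ (tail i' = j ∨ head i' = j) := by
                intro h
                have : i' ∈ (N.filter fun i => tail i = j ∨ head i = j) := by simp [hi', h]
                rw [hone] at this
                exact hii (by simpa using this)
              push Not at this
              exact ⟨0, fun _ => by simp [this.1, this.2]⟩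
            · obtain ⟨q, hq⟩ := hNint i' hi'
              refine ⟨q * ((if tail i' = j then 1 else 0) - (if head i' = j then 1 else 0)),
                fun _ => ?_⟩
              rw [hq]; push_cast; rfl
          choose q hq using this
          refine ⟨∑ i' ∈ Finset.univ.erase i, q i', ?_⟩
          push_cast
          exact Finset.sum_congr rfl fun i' hi' => hq i' (Finset.ne_of_mem_erase hi')
        obtain ⟨q, hq⟩ := hrest
        rw [hq] at hx
        have hni : ∀ m : ℤ, x i ≠ m := by simpa [hN] using hiN
        have hl := hloop i hiN
        rcases hij with h | h
        · have h' : head i ≠ j := fun h'' => hl (h.trans h''.symm)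
          apply hni (m - q); push_cast; simp [h, h'] at hx; linarith
        · have h' : tail i ≠ j := fun h'' => hl (h''.trans h.symm)
          apply hni (q - m); push_cast; simp [h, h'] at hx; linarith
      have h3 : ∑ j ∈ JN, (N.filter fun i => tail i = j ∨ head i = j).card ≤ 2 * N.card := by
        calc _ ≤ ∑ j ∈ JN, ((N.filter fun i => tail i = j).card +
              (N.filter fun i => head i = j).card) := by
              refine Finset.sum_le_sum fun j _ => ?_
              rw [Finset.filter_or]; exact Finset.card_union_le _ _
          _ = N.card + N.card := by
              rw [Finset.sum_add_distrib,
                ← Finset.card_eq_sum_card_fiberwise (f := tail) (t := JN),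
                ← Finset.card_eq_sum_card_fiberwise (f := head) (t := JN)]
              · intro i hi; simp only [hJN, Finset.coe_union]; right
                exact Finset.mem_coe.2 (Finset.mem_image_of_mem _ hi)
              · intro i hi; simp only [hJN, Finset.coe_union]; left
                exact Finset.mem_coe.2 (Finset.mem_image_of_mem _ hi)
          _ = _ := by ring
      have h4 := Finset.card_nsmul_le_sum JN _ 2 h2
      simp only [smul_eq_mul] at h4
      omega
    have hj0 : tail i₁ ∈ JN := by
      simp only [hJN, Finset.mem_union]; left; exact Finset.mem_image_of_mem _ hi₁
    -- Net flows sum to zero, so the equation at one touched node follows from the others. Dropping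
    -- it leaves fewer equations than fractional arcs.
    set K := JN.erase (tail i₁) with hK
    let A' : (I → ℝ) →ₗ[ℝ] (K → ℝ) := (LinearMap.funLeft ℝ ℝ (fun k : K => (k : J))) ∘ₗ
      netFlow tail head
    obtain ⟨z, hz0, hzA, hzN⟩ := exists_kernel_supported A' N (by
      simp only [Module.finrank_fintype_fun_eq_card, Fintype.card_coe]
      rw [hK, Finset.card_erase_of_mem hj0]
      have := Finset.card_pos.2 ⟨_, hj0⟩
      omega)
    apply hz0
    apply hker' z _ hzN
    have hne0 : ∀ j, j ≠ tail i₁ → netFlow tail head z j = 0 := by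
      intro j hj
      by_cases hjJ : j ∈ JN
      · have := congrFun hzA ⟨j, Finset.mem_erase.2 ⟨hj, hjJ⟩⟩
        simpa [A', LinearMap.funLeft] using this
      · rw [netFlow_apply]
        refine Finset.sum_eq_zero fun i _ => ?_
        by_cases hzi : z i = 0
        · simp [hzi]
        · have hi := hzN i hzi
          have h1 : tail i ≠ j := fun h => hjJ (by
            simp only [hJN, Finset.mem_union]; left; exact h ▸ Finset.mem_image_of_mem _ hi)
          have h2 : head i ≠ j := fun h => hjJ (by
            simp only [hJN, Finset.mem_union]; right; exact h ▸ Finset.mem_image_of_mem _ hi)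
          simp [h1, h2]
    ext j
    by_cases hj : j = tail i₁
    · have := sum_netFlow tail head z
      rw [← Finset.add_sum_erase _ _ (Finset.mem_univ (tail i₁)),
        Finset.sum_eq_zero (fun j hj => hne0 j (Finset.ne_of_mem_erase hj)), add_zero] at this
      simpa [hj] using this
    · simpa using hne0 j hj
  have hall : ∀ i, ∃ m : ℤ, x i = m := fun i => hNint i (by simp [hempty])
  choose m hm using hall
  refine ⟨m, fun i => ⟨?_, ?_⟩, ?_⟩
  · have := hl i; simp only [hm] at this; exact_mod_cast this
  · have := hu i; simp only [hm] at this; exact_mod_cast this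
  · rw [← hA]; congr 1; ext i; exact (hm i).symm

end NetworkIntegrality

/-! ### Rounding matrices and balanced orientations -/

section MatrixRounding

variable {V : Type*} [Fintype V]

/-- Rounding a nonnegative real matrix whose row and column sums are all equal to an integer. -/
theorem exists_rounded_matrix (x : V → V → ℝ) (σ : ℕ) (h0 : ∀ u v, 0 ≤ x u v)
    (hrow : ∀ u, ∑ v, x u v = σ) (hcol : ∀ v, ∑ u, x u v = σ) :
    ∃ y : V → V → ℕ, (∀ u v, ⌊x u v⌋ ≤ (y u v : ℤ) ∧ (y u v : ℤ) ≤ ⌈x u v⌉) ∧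
      (∀ u, ∑ v, y u v = σ) ∧ ∀ v, ∑ u, y u v = σ := by
  classical
  have hl : ∀ (z : V × V → ℝ) (u : V),
      netFlow (fun i : V × V => (Sum.inl i.1 : V ⊕ V)) (fun i => Sum.inr i.2) z (Sum.inl u) =
        ∑ v, z (u, v) := by
    intro z u
    rw [netFlow_apply, Fintype.sum_prod_type]
    simp
  have hr : ∀ (z : V × V → ℝ) (v : V),
      netFlow (fun i : V × V => (Sum.inl i.1 : V ⊕ V)) (fun i => Sum.inr i.2) z (Sum.inr v) =
        - ∑ u, z (u, v) := by
    intro z u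
    rw [netFlow_apply, Fintype.sum_prod_type]
    simp
  -- The matrix is a flow on the complete bipartite network from rows to columns.
  obtain ⟨y, hy, hflow⟩ := exists_integral_flow (fun i : V × V => (Sum.inl i.1 : V ⊕ V))
    (fun i => Sum.inr i.2) (fun i => x i.1 i.2) (by
      rintro (u | v)
      · exact ⟨σ, by rw [hl]; simp [hrow]⟩
      · exact ⟨-σ, by rw [hr]; simp [hcol]⟩)
  have hnn : ∀ i, 0 ≤ y i := fun i => (Int.floor_nonneg.2 (h0 _ _)).trans (hy i).1
  refine ⟨fun u v => (y (u, v)).toNat, fun u v => ?_, fun u => ?_, fun v => ?_⟩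
  · rw [Int.toNat_of_nonneg (hnn _)]; exact hy (u, v)
  · have := congrFun hflow (Sum.inl u)
    rw [hl, hl, hrow] at this
    have h : (∑ v, y (u, v)) = (σ : ℤ) := by exact_mod_cast this
    zify
    simp only [Int.toNat_of_nonneg (hnn _), h]
  · have := congrFun hflow (Sum.inr v)
    rw [hr, hr, hcol, neg_inj] at this
    have h : (∑ u, y (u, v)) = (σ : ℤ) := by exact_mod_cast this
    zify
    simp only [Int.toNat_of_nonneg (hnn _), h]

theorem netFlow_fst_snd [DecidableEq V] (z : V × V → ℝ) (u : V) :
    netFlow (Prod.fst : V × V → V) Prod.snd z u = ∑ v, (z (u, v) - z (v, u)) := by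
  rw [netFlow_apply, Fintype.sum_prod_type]
  simp [mul_sub, Finset.sum_sub_distrib]

/-- A loopless multigraph with even degrees has a balanced orientation in which parallel edges
are oriented as evenly as possible. -/
theorem exists_balanced_orientation [LinearOrder V] (R : V → V → ℕ) (m : ℕ)
    (hsymm : ∀ u v, R u v = R v u) (hdiag : ∀ u, R u u = 0) (hsum : ∀ u, ∑ v, R u v = 2 * m) :
    ∃ a : V → V → ℕ, (∀ u v, a u v + a v u = R u v) ∧ (∀ u v, a u v ≤ (R u v + 1) / 2) ∧
      ∀ u, ∑ v, a u v = m := by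
  -- On each pair, `R / 2` (rounded down) edges go each way. The one left over when `R` is odd is
  -- recorded on the arc from the smaller to the larger vertex: value 1 is that direction, 0 the
  -- reverse, and 1/2 the fractional compromise to be rounded.
  set x₀ : V × V → ℝ := fun i => if i.1 < i.2 ∧ Odd (R i.1 i.2) then 1 / 2 else 0 with hx₀
  have hsumR : ∀ u, ∑ v, (R u v : ℝ) = 2 * m := fun u => by exact_mod_cast hsum u
  have key : ∀ u v, ∃ k : ℤ, (R u v : ℝ) / 2 + (x₀ (u, v) - x₀ (v, u)) = k := by
    intro u v
    rcases lt_trichotomy u v with h | h | h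
    · by_cases ho : Odd (R u v)
      · obtain ⟨k, hk⟩ := ho
        refine ⟨k + 1, ?_⟩
        have : Odd (R u v) := ⟨k, hk⟩
        simp only [hx₀, h, this, h.not_gt, and_self, false_and, if_true, if_false]
        rw [hk]; push_cast; ring
      · obtain ⟨k, hk⟩ := Nat.not_odd_iff_even.1 ho
        refine ⟨k, ?_⟩
        simp only [hx₀, ho, h.not_gt, and_false, false_and, if_false]
        rw [hk]; push_cast; ring
    · subst h
      exact ⟨0, by simp [hdiag]⟩
    · by_cases ho : Odd (R v u)
      · obtain ⟨k, hk⟩ := ho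
        refine ⟨k, ?_⟩
        have : Odd (R v u) := ⟨k, hk⟩
        simp only [hx₀, h, this, h.not_gt, and_self, false_and, if_true, if_false]
        rw [hsymm u v, hk]; push_cast; ring
      · obtain ⟨k, hk⟩ := Nat.not_odd_iff_even.1 ho
        refine ⟨k, ?_⟩
        simp only [hx₀, ho, h.not_gt, and_false, false_and, if_false]
        rw [hsymm u v, hk]; push_cast; ring
  have hint : ∀ u, ∃ k : ℤ, netFlow (Prod.fst : V × V → V) Prod.snd x₀ u = k := by
    intro u
    choose k hk using fun v => key u v
    refine ⟨∑ v, k v - m, ?_⟩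
    rw [netFlow_fst_snd]
    push_cast
    rw [← Finset.sum_congr rfl fun v _ => hk v, Finset.sum_add_distrib, ← Finset.sum_div, hsumR]
    ring
  obtain ⟨x, hx, hflow⟩ := exists_integral_flow _ _ _ hint
  have hx01 : ∀ i, x i = 0 ∨ (x i = 1 ∧ i.1 < i.2 ∧ Odd (R i.1 i.2)) := by
    intro i
    have := hx i
    by_cases h : i.1 < i.2 ∧ Odd (R i.1 i.2)
    · simp only [hx₀, h, and_self, if_true] at this
      norm_num at this
      have h1 : x i = 0 ∨ x i = 1 := by omega
      tauto
    · simp only [hx₀, h, if_false] at this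
      norm_num at this
      left; omega
  refine ⟨fun u v => if v < u ∧ Odd (R u v) then (R u v + 1) / 2 - (x (v, u)).toNat
    else R u v / 2 + (x (u, v)).toNat, ?_, ?_, ?_⟩
  · intro u v
    rcases lt_trichotomy u v with h | h | h
    · have h1 := hx01 (u, v)
      have h2 := hx01 (v, u)
      by_cases ho : Odd (R u v)
      · simp only [h, h.not_gt, ho, false_and, true_and, if_true, if_false, hsymm v u]
        obtain ⟨k, hk⟩ := ho
        rcases h1 with h1 | ⟨h1, -⟩ <;> rw [h1, hk] <;> simp <;> omega
      · have ho' : ¬ Odd (R v u) := hsymm u v ▸ ho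
        simp only [ho, ho', and_false, or_false] at h1 h2
        simp only [ho, and_false, if_false, h1, h2, hsymm v u]
        obtain ⟨k, hk⟩ := Nat.not_odd_iff_even.1 ho
        simp; omega
    · subst h
      have h1 := hx01 (u, u)
      simp at h1
      simp [h1, hdiag]
    · have h1 := hx01 (v, u)
      have h2 := hx01 (u, v)
      by_cases ho : Odd (R u v)
      · simp only [h, h.not_gt, ho, false_and, true_and, if_true, if_false, hsymm v u]
        obtain ⟨k, hk⟩ := ho
        rcases h1 with h1 | ⟨h1, -⟩ <;> rw [h1, hk] <;> simp <;> omega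
      · have ho' : ¬ Odd (R v u) := hsymm u v ▸ ho
        simp only [ho, ho', and_false, or_false] at h1 h2
        simp only [ho, and_false, if_false, h1, h2, hsymm v u]
        obtain ⟨k, hk⟩ := Nat.not_odd_iff_even.1 ho
        simp; omega
  · intro u v
    beta_reduce
    split_ifs with h
    · omega
    · rcases hx01 (u, v) with h1 | ⟨h1, -, h2⟩
      · rw [h1]; simp; omega
      · rw [h1]; obtain ⟨k, hk⟩ := h2; simp only at hk; rw [hk]; simp; omega
  · intro u
    have hreal : ∀ v, (((if v < u ∧ Odd (R u v) then (R u v + 1) / 2 - (x (v, u)).toNat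
        else R u v / 2 + (x (u, v)).toNat : ℕ)) : ℝ) =
        (R u v : ℝ) / 2 + (((x (u, v) : ℝ) - x (v, u)) - (x₀ (u, v) - x₀ (v, u))) := by
      intro v
      have h1 := hx01 (u, v)
      have h2 := hx01 (v, u)
      by_cases ho : Odd (R u v)
      · have ho' : Odd (R v u) := hsymm u v ▸ ho
        have ho2 := ho
        obtain ⟨k, hk⟩ := ho2
        rcases lt_trichotomy u v with h | h | h
        · have h3 : x (v, u) = 0 := by simpa [h.not_gt] using h2
          simp only [hx₀, h, h.not_gt, ho, false_and, true_and, if_true, if_false, h3]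
          rcases h1 with h1 | ⟨h1, -⟩ <;> rw [h1, hk]
          · have : (2 * k + 1) / 2 = k := by omega
            simp [this]; ring
          · have : (2 * k + 1) / 2 = k := by omega
            simp [this]; ring
        · subst h; simp [hdiag] at ho
        · have h3 : x (u, v) = 0 := by simpa [h.not_gt] using h1
          simp only [hx₀, h, h.not_gt, ho, ho', false_and, true_and, if_true, if_false, h3]
          rcases h2 with h1 | ⟨h1, -⟩ <;> rw [h1, hk]
          · have : (2 * k + 1 + 1) / 2 = k + 1 := by omega
            simp [this]; ring
          · have : (2 * k + 1 + 1) / 2 = k + 1 := by omega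
            simp [this]; ring
      · have ho' : ¬ Odd (R v u) := hsymm u v ▸ ho
        simp only [ho, ho', and_false, or_false] at h1 h2
        obtain ⟨k, hk⟩ := Nat.not_odd_iff_even.1 ho
        simp only [hx₀, ho, ho', and_false, if_false, h1, h2]
        have : (k + k) / 2 = k := by omega
        rw [hk, this]; simp
    have h := congrFun hflow u
    rw [netFlow_fst_snd, netFlow_fst_snd] at h
    have : ∑ v, (((if v < u ∧ Odd (R u v) then (R u v + 1) / 2 - (x (v, u)).toNat
        else R u v / 2 + (x (u, v)).toNat : ℕ)) : ℝ) = m := by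
      rw [Finset.sum_congr rfl fun v _ => hreal v, Finset.sum_add_distrib,
        Finset.sum_sub_distrib, h, ← Finset.sum_div, hsumR]
      ring
    exact_mod_cast this

/-- The fractional multigraph `μ / r` can be oriented, with sum of the two directions fixed, so
that all but at most `|V|` of the edges of multiplicity one use only one direction. -/
theorem exists_tight_orientation [LinearOrder V] (μ : V → V → ℕ) (r s : ℕ) (hr : 0 < r)
    (hsymm : ∀ u v, μ u v = μ v u) (hdiag : ∀ u, μ u u = 0) (hsum : ∀ u, ∑ v, μ u v = r * s) :
    ∃ (x : V → V → ℝ) (N : Finset (V × V)), N.card ≤ Fintype.card V ∧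
      (∀ u v, x u v + x v u = 2 * μ u v / r) ∧ (∀ u, ∑ v, x u v = s) ∧
      (∀ u v, μ u v ≠ 1 → x u v = μ u v / r) ∧
      (∀ u v, μ u v = 1 → 0 ≤ x u v ∧ x u v ≤ 2 / r) ∧
      ∀ u v, μ u v = 1 → 0 < x u v → 0 < x v u → (u, v) ∈ N ∨ (v, u) ∈ N := by
  classical
  have hr' : (0 : ℝ) < r := by exact_mod_cast hr
  have hb : (0 : ℝ) ≤ 1 / r := by positivity
  -- The variable `z` shifts weight between the two directions of an edge of multiplicity one. At
  -- `±1 / r` one direction carries `2 / r` and the other nothing.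
  set b : V × V → ℝ := fun i => if i.1 < i.2 ∧ μ i.1 i.2 = 1 then 1 / r else 0 with hbdef
  have hb0 : ∀ i, 0 ≤ b i := by intro i; simp only [hbdef]; split_ifs <;> simp
  obtain ⟨z, hl, hu, hA, hker⟩ := exists_basic_solution
    (netFlow (Prod.fst : V × V → V) Prod.snd) (fun i => - b i) b 0
    (fun i => by simpa using hb0 i) (fun i => by simpa using hb0 i)
  have hz0 : ∀ i : V × V, ¬ (i.1 < i.2 ∧ μ i.1 i.2 = 1) → z i = 0 := by
    intro i hi
    have h1 := hl i
    have h2 := hu i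
    simp only [hbdef, hi, if_false] at h1 h2
    linarith
  have hzb : ∀ i : V × V, -(1 / r : ℝ) ≤ z i ∧ z i ≤ 1 / r := by
    intro i
    by_cases hi : i.1 < i.2 ∧ μ i.1 i.2 = 1
    · have h1 := hl i
      have h2 := hu i
      simp only [hbdef, hi, and_self, if_true] at h1 h2
      exact ⟨h1, h2⟩
    · rw [hz0 i hi]; constructor <;> linarith
  refine ⟨fun u v => μ u v / r + (z (u, v) - z (v, u)),
    Finset.univ.filter fun i => - b i < z i ∧ z i < b i, ?_, ?_, ?_, ?_, ?_, ?_⟩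
  -- More than `|V|` strictly slack coordinates would carry a nonzero circulation, contradicting
  -- basicness.
  · by_contra hlt
    obtain ⟨w, hw, hwA, hwN⟩ := exists_kernel_supported (netFlow (Prod.fst : V × V → V) Prod.snd)
      (Finset.univ.filter fun i => - b i < z i ∧ z i < b i) (by
        rw [Module.finrank_fintype_fun_eq_card]; omega)
    exact hw (hker w hwA fun i hi => by simpa using hwN i hi)
  · intro u v
    beta_reduce
    rw [hsymm v u]; ring
  · intro u
    have h := congrFun hA u
    rw [netFlow_fst_snd, map_zero] at h
    rw [Finset.sum_add_distrib, h, ← Finset.sum_div]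
    have : ∑ v, (μ u v : ℝ) = r * s := by exact_mod_cast hsum u
    rw [this]; simp; field_simp
  · intro u v h
    have h' : μ v u ≠ 1 := hsymm u v ▸ h
    beta_reduce
    rw [hz0 (u, v) (by simp [h]), hz0 (v, u) (by simp [h'])]; ring
  · intro u v h
    have h1 := hzb (u, v)
    have h2 := hzb (v, u)
    beta_reduce
    rw [h]
    have h3 : z (u, v) = 0 ∨ z (v, u) = 0 := by
      rcases le_total u v with h | h
      · right; apply hz0; simp [h.not_gt]
      · left; apply hz0; simp [h.not_gt]
    have e : (2 : ℝ) / r = 1 / r + 1 / r := by ring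
    rw [e]
    push_cast
    rcases h3 with h3 | h3 <;> rw [h3] <;> constructor <;> linarith
  · have aux : ∀ u v, u < v → μ u v = 1 → 0 < (μ u v : ℝ) / r + (z (u, v) - z (v, u)) →
        0 < (μ v u : ℝ) / r + (z (v, u) - z (u, v)) → - b (u, v) < z (u, v) ∧ z (u, v) < b (u, v) := by
      intro u v huv h h1 h2
      have h3 : z (v, u) = 0 := hz0 _ (by simp [huv.not_gt])
      have h4 : b (u, v) = 1 / r := by simp [hbdef, huv, h]
      rw [hsymm v u] at h2
      rw [h, h3] at h1 h2
      rw [h4]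
      push_cast at h1 h2
      constructor <;> linarith
    intro u v h h1 h2
    rcases lt_trichotomy u v with huv | huv | huv
    · left; simpa using aux u v huv h h1 h2
    · subst huv; simp [hdiag] at h
    · right; simpa using aux v u huv (hsymm u v ▸ h) h2 h1

/-- A natural number matrix with entries at most `t` and all row and column sums `t * σ` is the
sum of `t` zero-one matrices with row and column sums `σ`. -/
theorem exists_zero_one_decomposition (σ : ℕ) : ∀ (t : ℕ) (a : V → V → ℕ), (∀ u v, a u v ≤ t) →
    (∀ u, ∑ v, a u v = t * σ) → (∀ v, ∑ u, a u v = t * σ) →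
    ∃ y : Fin t → V → V → ℕ, (∀ i u v, y i u v ≤ 1) ∧ (∀ i u, ∑ v, y i u v = σ) ∧
      (∀ i v, ∑ u, y i u v = σ) ∧ ∀ u v, ∑ i, y i u v = a u v
  | 0, a, hle, _, _ =>
    ⟨fun i => i.elim0, fun i => i.elim0, fun i => i.elim0, fun i => i.elim0, fun u v => by
      have := hle u v; simp; omega⟩
  | t + 1, a, hle, hrow, hcol => by
    have ht : (0 : ℝ) < t + 1 := by positivity
    -- Rounding `a / (t + 1)` sends full entries `t + 1` to 1 and zero entries to 0, so subtracting
    -- the result lowers the entry bound to `t`.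
    obtain ⟨y, hy, hyr, hyc⟩ := exists_rounded_matrix (fun u v => (a u v : ℝ) / (t + 1)) σ
      (fun u v => by positivity)
      (fun u => by
        have : ∑ v, (a u v : ℝ) = (t + 1) * σ := by exact_mod_cast hrow u
        rw [← Finset.sum_div, this]; field_simp)
      (fun v => by
        have : ∑ u, (a u v : ℝ) = (t + 1) * σ := by exact_mod_cast hcol v
        rw [← Finset.sum_div, this]; field_simp)
    have hfull : ∀ u v, a u v = t + 1 → 1 ≤ y u v := by
      intro u v h
      have := (hy u v).1
      rw [h] at this
      push_cast at this
      rw [div_self ht.ne'] at this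
      simp at this; exact_mod_cast this
    have hzero : ∀ u v, a u v = 0 → y u v = 0 := by
      intro u v h
      have := (hy u v).2
      rw [h] at this
      simpa using this
    have hone : ∀ u v, y u v ≤ 1 := by
      intro u v
      have h1 := (hy u v).2
      have h2 : ⌈(a u v : ℝ) / (t + 1)⌉ ≤ 1 := by
        rw [Int.ceil_le]
        have : (a u v : ℝ) ≤ t + 1 := by exact_mod_cast hle u v
        rw [div_le_iff₀ ht]; simpa using this
      exact_mod_cast h1.trans h2
    have hya : ∀ u v, y u v ≤ a u v := by
      intro u v
      by_cases h : a u v = 0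
      · rw [hzero u v h]; omega
      · have := hone u v; omega
    obtain ⟨y', h1, h2, h3, h4⟩ := exists_zero_one_decomposition σ t
      (fun u v => a u v - y u v)
      (fun u v => by
        have := hle u v
        by_cases h : a u v = t + 1
        · have := hfull u v h; omega
        · omega)
      (fun u => by
        rw [Finset.sum_tsub_distrib _ fun v _ => hya u v, hrow, hyr]
        rw [add_mul]; omega)
      (fun v => by
        rw [Finset.sum_tsub_distrib _ fun u _ => hya u v, hcol, hyc]
        rw [add_mul]; omega)
    refine ⟨Fin.cons y y', ?_, ?_, ?_, ?_⟩
    · intro i; refine Fin.cases ?_ (fun i => ?_) i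
      · simpa using hone
      · simpa using h1 i
    · intro i; refine Fin.cases ?_ (fun i => ?_) i
      · simpa using hyr
      · simpa using h2 i
    · intro i; refine Fin.cases ?_ (fun i => ?_) i
      · simpa using hyc
      · simpa using h3 i
    · intro u v
      rw [Fin.sum_univ_succ]
      have := hya u v
      simp only [Fin.cons_zero, Fin.cons_succ, h4]; omega

end MatrixRounding

/-! ### Hamilton cycles: closure, Pósa's condition and Dirac's theorem -/

namespace SimpleGraph

variable {V : Type*} [Fintype V]

open Classical in
/-- The number of neighbours of a vertex. -/
noncomputable def nbrCount (H : SimpleGraph V) (v : V) : ℕ :=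
  (Finset.univ.filter fun x => H.Adj v x).card

theorem nbrCount_mono {H K : SimpleGraph V} (h : H ≤ K) (v : V) : H.nbrCount v ≤ K.nbrCount v := by
  classical
  exact Finset.card_le_card fun x hx => by
    simp only [Finset.mem_filter, Finset.mem_univ, true_and] at hx ⊢
    exact h hx

/-- The vertices can be listed cyclically so that consecutive ones are adjacent. -/
def HasHamiltonCycle (H : SimpleGraph V) : Prop :=
  ∃ w : ℕ → V, Set.InjOn w (Set.Iio (Fintype.card V)) ∧
    ∀ i < Fintype.card V, H.Adj (w i) (w ((i + 1) % Fintype.card V))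

theorem exists_eq_of_injOn {w : ℕ → V} (hw : Set.InjOn w (Set.Iio (Fintype.card V))) (x : V) :
    ∃ i < Fintype.card V, w i = x := by
  have hinj : Function.Injective fun i : Fin (Fintype.card V) => w i := fun i j h =>
    Fin.ext (hw i.2 j.2 h)
  have := (Fintype.bijective_iff_injective_and_card _).2 ⟨hinj, by simp⟩
  obtain ⟨i, hi⟩ := this.2 x
  exact ⟨i, i.2, hi⟩

/-- A Hamilton path whose ends have degree sum at least `|V|` gives a Hamilton cycle. -/
theorem hasHamiltonCycle_of_path (H : SimpleGraph V) (w : ℕ → V)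
    (hw : Set.InjOn w (Set.Iio (Fintype.card V)))
    (hpath : ∀ i, i + 1 < Fintype.card V → H.Adj (w i) (w (i + 1)))
    (hdeg : Fintype.card V ≤ H.nbrCount (w 0) + H.nbrCount (w (Fintype.card V - 1))) :
    H.HasHamiltonCycle := by
  classical
  set n := Fintype.card V with hn
  have hn0 : 0 < n := Fintype.card_pos_iff.2 ⟨w 0⟩
  have hA : H.nbrCount (w 0) ≤
      ((Finset.range (n - 1)).filter fun j => H.Adj (w 0) (w (j + 1))).card := by
    calc H.nbrCount (w 0) ≤ (((Finset.range (n - 1)).filter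
          fun j => H.Adj (w 0) (w (j + 1))).image fun j => w (j + 1)).card := by
          refine Finset.card_le_card fun x hx => ?_
          simp only [Finset.mem_filter, Finset.mem_univ, true_and] at hx
          obtain ⟨i, hi, rfl⟩ := exists_eq_of_injOn hw x
          have hi0 : i ≠ 0 := by rintro rfl; exact hx.ne rfl
          refine Finset.mem_image.2 ⟨i - 1, ?_, by rw [Nat.sub_add_cancel (by omega)]⟩
          rw [Finset.mem_filter, Finset.mem_range, Nat.sub_add_cancel (by omega)]
          exact ⟨by omega, hx⟩
      _ ≤ _ := Finset.card_image_le
  have hB : H.nbrCount (w (n - 1)) ≤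
      ((Finset.range (n - 1)).filter fun j => H.Adj (w (n - 1)) (w j)).card := by
    calc H.nbrCount (w (n - 1)) ≤ (((Finset.range (n - 1)).filter
          fun j => H.Adj (w (n - 1)) (w j)).image fun j => w j).card := by
          refine Finset.card_le_card fun x hx => ?_
          simp only [Finset.mem_filter, Finset.mem_univ, true_and] at hx
          obtain ⟨i, hi, rfl⟩ := exists_eq_of_injOn hw x
          have hi0 : i ≠ n - 1 := by rintro rfl; exact hx.ne rfl
          refine Finset.mem_image.2 ⟨i, ?_, rfl⟩
          rw [Finset.mem_filter, Finset.mem_range]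
          exact ⟨by omega, hx⟩
      _ ≤ _ := Finset.card_image_le
  -- Two sets of indices below `n - 1` with total size at least `n` must meet.
  obtain ⟨j, hjlt, hja, hjb⟩ : ∃ j, j < n - 1 ∧ H.Adj (w 0) (w (j + 1)) ∧
      H.Adj (w (n - 1)) (w j) := by
    by_contra! hno
    have hdisj : Disjoint ((Finset.range (n - 1)).filter fun j => H.Adj (w 0) (w (j + 1)))
        ((Finset.range (n - 1)).filter fun j => H.Adj (w (n - 1)) (w j)) := by
      rw [Finset.disjoint_left]
      intro j h1 h2
      simp only [Finset.mem_filter, Finset.mem_range] at h1 h2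
      exact hno j h1.1 h1.2 h2.2
    have h1 := Finset.card_union_of_disjoint hdisj
    have h2 := Finset.card_le_card (Finset.union_subset
      (Finset.filter_subset (fun j => H.Adj (w 0) (w (j + 1))) (Finset.range (n - 1)))
      (Finset.filter_subset (fun j => H.Adj (w (n - 1)) (w j)) (Finset.range (n - 1))))
    rw [Finset.card_range] at h2
    omega
  -- The cycle follows the path up to `w j`, jumps to its last vertex, and runs backwards to `w (j +
  -- 1)`, which is adjacent to `w 0`.
  refine ⟨fun i => if i ≤ j then w i else w (n + j - i), ?_, ?_⟩
  · intro a ha b hb hab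
    simp only [Set.mem_Iio] at ha hb
    dsimp only at hab
    split_ifs at hab with h1 h2 h2
    · exact hw ha hb hab
    · have := hw (Set.mem_Iio.2 ha) (Set.mem_Iio.2 (by omega)) hab; omega
    · have := hw (Set.mem_Iio.2 (by omega)) (Set.mem_Iio.2 hb) hab; omega
    · have := hw (Set.mem_Iio.2 (by omega)) (Set.mem_Iio.2 (by omega)) hab; omega
  · intro i hi
    change i < n at hi
    change H.Adj (if i ≤ j then _ else _) (if (i + 1) % n ≤ j then _ else _)
    by_cases hlast : i + 1 = n
    · have hji : n + j - i = j + 1 := by omega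
      rw [hlast, Nat.mod_self, if_neg (by omega), if_pos (Nat.zero_le _), hji]
      exact hja.symm
    · rw [Nat.mod_eq_of_lt (by omega)]
      rcases lt_trichotomy i j with h | h | h
      · rw [if_pos h.le, if_pos (by omega)]; exact hpath i (by omega)
      · subst h
        rw [if_pos le_rfl, if_neg (by omega)]
        have : n + i - (i + 1) = n - 1 := by omega
        rw [this]; exact hjb.symm
      · rw [if_neg (by omega), if_neg (by omega)]
        have : n + j - i = n + j - (i + 1) + 1 := by omega
        rw [this]; exact (hpath _ (by omega)).symm

/-- The closure lemma of Bondy and Chvátal. -/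
theorem hasHamiltonCycle_of_sup_edge (H : SimpleGraph V) (hn : 3 ≤ Fintype.card V) (u v : V)
    (hdeg : Fintype.card V ≤ H.nbrCount u + H.nbrCount v)
    (hham : (H ⊔ edge u v).HasHamiltonCycle) : H.HasHamiltonCycle := by
  obtain ⟨w, hw, hadj⟩ := hham
  by_cases hall : ∀ i < Fintype.card V, H.Adj (w i) (w ((i + 1) % Fintype.card V))
  · exact ⟨w, hw, hall⟩
  push Not at hall
  obtain ⟨i₀, hi₀, hnot⟩ := hall
  set n := Fintype.card V with hndef
  have hmod : ∀ j, j % n < n := fun j => Nat.mod_lt _ (by omega)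
  have hends : ∀ i < n, ¬ H.Adj (w i) (w ((i + 1) % n)) →
      (w i = u ∧ w ((i + 1) % n) = v) ∨ (w i = v ∧ w ((i + 1) % n) = u) := by
    intro i hi hnot
    have := hadj i hi
    simp only [sup_adj, hnot, false_or, edge_adj] at this
    tauto
  have h1 : ∀ j, j + 1 < n → (i₀ + 1 + (j + 1)) % n = ((i₀ + 1 + j) % n + 1) % n := by
    intro j _
    rw [Nat.mod_add_mod]; rfl
  have hinj : ∀ a b, a < n → b < n → (i₀ + 1 + a) % n = (i₀ + 1 + b) % n → a = b := by
    intro a b ha hb h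
    have := Nat.ModEq.add_left_cancel' (i₀ + 1) (show i₀ + 1 + a ≡ i₀ + 1 + b [MOD n] from h)
    rwa [Nat.ModEq, Nat.mod_eq_of_lt ha, Nat.mod_eq_of_lt hb] at this
  have hlast : (i₀ + 1 + (n - 1)) % n = i₀ := by
    have : i₀ + 1 + (n - 1) = i₀ + n := by omega
    rw [this, Nat.add_mod_right, Nat.mod_eq_of_lt hi₀]
  -- Cut the cycle at its edge missing from `H`, which joins `u` and `v`. A cycle uses that edge
  -- only once, so the rest is a Hamilton path in `H`.
  apply hasHamiltonCycle_of_path H fun j => w ((i₀ + 1 + j) % n)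
  · intro a ha b hb hab
    exact hinj a b ha hb (hw (Set.mem_Iio.2 (hmod _)) (Set.mem_Iio.2 (hmod _)) hab)
  · intro j hj
    by_contra hno
    change j + 1 < n at hj
    rw [h1 j hj] at hno
    have e1 := hends _ hi₀ hnot
    have e2 := hends _ (hmod _) hno
    have hne : (i₀ + 1 + j) % n ≠ i₀ := by
      intro h
      have := hinj j (n - 1) (by omega) (by omega) (by rw [h, hlast])
      omega
    have hne2 : ∀ h : w ((i₀ + 1 + j) % n) = w i₀, False := fun h =>
      hne (hw (Set.mem_Iio.2 (hmod _)) (Set.mem_Iio.2 hi₀) h)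
    have h3 : w ((i₀ + 1 + j) % n) = w ((i₀ + 1) % n) ∧
        w (((i₀ + 1 + j) % n + 1) % n) = w i₀ := by
      rcases e1 with ⟨a, b⟩ | ⟨a, b⟩ <;> rcases e2 with ⟨c, d⟩ | ⟨c, d⟩
      · exact (hne2 (c.trans a.symm)).elim
      · exact ⟨c.trans b.symm, d.trans a.symm⟩
      · exact ⟨c.trans b.symm, d.trans a.symm⟩
      · exact (hne2 (c.trans a.symm)).elim
    have h4 := hinj j 0 (by omega) (by omega)
      (hw (Set.mem_Iio.2 (hmod _)) (Set.mem_Iio.2 (hmod _)) h3.1)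
    have h5 := hw (Set.mem_Iio.2 (hmod _)) (Set.mem_Iio.2 hi₀) h3.2
    rw [← h1 j hj] at h5
    have := hinj (j + 1) (n - 1) hj (by omega) (by rw [h5, hlast])
    omega
  · simp only [add_zero, ← hndef, hlast]
    rcases hends _ hi₀ hnot with ⟨a, b⟩ | ⟨a, b⟩ <;> rw [a, b] <;> omega

/-- Pósa's sufficient condition for a Hamilton cycle. -/
theorem hasHamiltonCycle_of_posa (H : SimpleGraph V) (hn : 3 ≤ Fintype.card V)
    (hcond : ∀ k, 1 ≤ k → 2 * k < Fintype.card V →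
      {v | H.nbrCount v ≤ k}.ncard < k) : H.HasHamiltonCycle := by
  classical
  by_contra hham
  -- Pass to an edge-maximal non-Hamiltonian supergraph, where the closure lemma bounds the degree
  -- sum of every non-adjacent pair.
  obtain ⟨K, hHK, hK⟩ := (Set.toFinite {K : SimpleGraph V | ¬ K.HasHamiltonCycle}).exists_le_maximal
    hham
  have hcondK : ∀ k, 1 ≤ k → 2 * k < Fintype.card V → {v | K.nbrCount v ≤ k}.ncard < k := by
    intro k h1 h2
    refine lt_of_le_of_lt (Set.ncard_le_ncard ?_ (Set.toFinite _)) (hcond k h1 h2)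
    intro v hv
    exact (nbrCount_mono hHK v).trans hv
  have hsum : ∀ u v, u ≠ v → ¬ K.Adj u v → K.nbrCount u + K.nbrCount v < Fintype.card V := by
    intro u v huv hnadj
    by_contra! hle
    refine hK.1 (hasHamiltonCycle_of_sup_edge K hn u v hle ?_)
    by_contra hno
    have := hK.2 hno le_sup_left
    apply hnadj
    apply this
    simp [edge_adj, huv]
  have hex : ∃ q : V × V, q.1 ≠ q.2 ∧ ¬ K.Adj q.1 q.2 := by
    by_contra! hall
    apply hK.1
    let e := Fintype.equivFin V
    refine ⟨fun i => e.symm ⟨i % Fintype.card V, Nat.mod_lt _ (by omega)⟩, ?_, ?_⟩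
    · intro a ha b hb hab
      have := congrArg Fin.val (e.symm.injective hab)
      simpa [Nat.mod_eq_of_lt (Set.mem_Iio.1 ha), Nat.mod_eq_of_lt (Set.mem_Iio.1 hb)] using this
    · intro i hi
      apply hall (_, _)
      intro h
      have := congrArg Fin.val (e.symm.injective h)
      simp only [Nat.mod_mod, Nat.mod_eq_of_lt hi] at this
      by_cases h' : i + 1 = Fintype.card V
      · rw [h', Nat.mod_self] at this; omega
      · rw [Nat.mod_eq_of_lt (by omega)] at this; omega
  obtain ⟨q, hq, hmax⟩ := (Set.toFinite {q : V × V | q.1 ≠ q.2 ∧ ¬ K.Adj q.1 q.2}).exists_maximalFor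
    (fun q => K.nbrCount q.1 + K.nbrCount q.2) _ hex
  obtain ⟨u, v, huv, hnadj, hle, hmax'⟩ : ∃ u v, u ≠ v ∧ ¬ K.Adj u v ∧
      K.nbrCount u ≤ K.nbrCount v ∧ ∀ x, x ≠ v → ¬ K.Adj x v → K.nbrCount x ≤ K.nbrCount u := by
    rcases le_total (K.nbrCount q.1) (K.nbrCount q.2) with h | h
    · refine ⟨q.1, q.2, hq.1, hq.2, h, fun x hx hxa => ?_⟩
      have := @hmax (x, q.2) ⟨hx, hxa⟩
      dsimp only at this; omega
    · refine ⟨q.2, q.1, hq.1.symm, fun h => hq.2 h.symm, h, fun x hx hxa => ?_⟩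
      have := @hmax (x, q.1) ⟨hx, hxa⟩
      dsimp only at this; omega
  have hs := hsum u v huv hnadj
  -- The choice of the pair makes every non-neighbour of `v` have degree at most that of `u`. As the
  -- two degrees sum to less than `|V|`, there are at least `K.nbrCount u` such vertices, violating
  -- the condition at `k = K.nbrCount u`.
  have hcount : Fintype.card V - 1 - K.nbrCount v ≤ {x | K.nbrCount x ≤ K.nbrCount u}.ncard := by
    have h1 : (Finset.univ.filter fun x => x ≠ v ∧ ¬ K.Adj x v).card =
        Fintype.card V - 1 - K.nbrCount v := by
      have : (Finset.univ.filter fun x => x ≠ v ∧ ¬ K.Adj x v) =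
          (Finset.univ.erase v) \ (Finset.univ.filter fun x => K.Adj v x) := by
        ext x
        simp [K.adj_comm]
      rw [this, Finset.card_sdiff_of_subset, Finset.card_erase_of_mem (Finset.mem_univ _)]
      · rfl
      · intro x hx
        simp only [Finset.mem_filter, Finset.mem_univ, true_and] at hx
        simp [hx.ne.symm]
    rw [← h1, ← Set.ncard_coe_finset]
    refine Set.ncard_le_ncard (fun x hx => ?_) (Set.toFinite _)
    simp only [Finset.coe_filter, Finset.mem_univ, true_and, Set.mem_ofPred_eq] at hx
    exact hmax' x hx.1 hx.2
  -- The condition says nothing for `k = 0`; an isolated vertex is excluded by `k = 1`.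
  by_cases h0 : K.nbrCount u = 0
  · have h2 := hcondK 1 le_rfl (by omega)
    have h3 : {x | K.nbrCount x ≤ 1} = ∅ := by
      rw [← Set.ncard_eq_zero (Set.toFinite _)]; omega
    have : u ∈ {x | K.nbrCount x ≤ 1} := by simp [h0]
    rw [h3] at this
    exact this
  · have := hcondK (K.nbrCount u) (by omega) (by omega)
    omega

/-- Dirac's theorem. -/
theorem hasHamiltonCycle_of_dirac (H : SimpleGraph V) (hn : 3 ≤ Fintype.card V)
    (hdeg : ∀ v, Fintype.card V ≤ 2 * H.nbrCount v) : H.HasHamiltonCycle := by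
  refine hasHamiltonCycle_of_posa H hn fun k h1 h2 => ?_
  have : {v | H.nbrCount v ≤ k} = ∅ := by
    ext v
    simp only [Set.mem_ofPred_eq, Set.mem_empty_iff_false, iff_false]
    have := hdeg v
    omega
  rw [this, Set.ncard_empty]; omega

end SimpleGraph

/-! ### Euler tours and halving degrees by alternation -/

namespace List

/-- The entries of a list at even positions (`true`) or at odd positions (`false`). -/
def alternate {α : Type*} : Bool → List α → List α
  | _, [] => []
  | true, a :: l => a :: alternate false l
  | false, _ :: l => alternate true l

theorem alternate_sublist {α : Type*} : ∀ (b : Bool) (l : List α), (l.alternate b).Sublist l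
  | true, [] => by simp [alternate]
  | false, [] => by simp [alternate]
  | true, a :: l => (alternate_sublist false l).cons_cons a
  | false, a :: l => (alternate_sublist true l).cons a

theorem countP_alternate_add {α : Type*} (p : α → Bool) : ∀ l : List α,
    (l.alternate true).countP p + (l.alternate false).countP p = l.countP p
  | [] => by simp [alternate]
  | a :: l => by
    have := countP_alternate_add p l
    simp only [alternate, countP_cons]
    omega

end List

namespace SimpleGraph

variable {V : Type*}

/-- Each passage through an inner vertex uses two consecutive edges, of opposite sign, so only the
ends of the walk contribute. For a closed walk of even length these contributions cancel too. -/
theorem countP_mem_alternate [DecidableEq V] {L : SimpleGraph V} (v : V) :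
    ∀ {u w : V} (p : L.Walk u w),
      ((p.edges.alternate true).countP (v ∈ ·) : ℤ) - (p.edges.alternate false).countP (v ∈ ·) =
        (if v = u then 1 else 0) - (-1) ^ p.length * (if v = w then 1 else 0)
  | _, _, .nil => by simp [List.alternate]
  | u, w, .cons (v := x) h p => by
    have ih := countP_mem_alternate v p
    have hmem : ((if v ∈ s(u, x) then 1 else 0 : ℕ) : ℤ) =
        (if v = u then 1 else 0) + (if v = x then 1 else 0) := by
      have := h.ne
      by_cases h1 : v = u <;> by_cases h2 : v = x <;> simp_all
    simp only [Walk.edges_cons, List.alternate, List.countP_cons, decide_eq_true_eq,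
      Walk.length_cons, pow_succ]
    rw [Nat.cast_add, hmem]
    linarith

variable [Fintype V]

theorem card_filter_mem_edges [DecidableEq V] (l : List (Sym2 V)) (hl : l.Nodup) (v : V) :
    (Finset.univ.filter fun x => s(v, x) ∈ l).card = l.countP (v ∈ ·) := by
  rw [List.countP_eq_length_filter, ← List.toFinset_card_of_nodup (hl.filter _)]
  refine Finset.card_bij (fun x _ => s(v, x)) ?_ ?_ ?_
  · intro x hx
    simpa using hx
  · intro x _ y _ hxy
    exact Sym2.congr_right.1 hxy
  · intro e he
    simp only [List.mem_toFinset, List.mem_filter, decide_eq_true_eq] at he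
    obtain ⟨x, rfl⟩ := Sym2.mem_iff_exists.1 he.2
    exact ⟨x, by simpa using he.1, rfl⟩

theorem sum_countP_mem_edges [DecidableEq V] : ∀ (l : List (Sym2 V)), (∀ e ∈ l, ¬ e.IsDiag) →
    ∑ v, l.countP (v ∈ ·) = 2 * l.length
  | [], _ => by simp
  | e :: l, hd => by
    have ih := sum_countP_mem_edges l fun e he => hd e (List.mem_cons_of_mem _ he)
    have h2 : ∑ v : V, (if v ∈ e then 1 else 0) = 2 := by
      rw [← Sym2.card_toFinset_of_not_isDiag e (hd e List.mem_cons_self),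
        Finset.card_eq_sum_ones, ← Finset.sum_filter]
      congr 1
      ext v; simp
    simp only [List.countP_cons, decide_eq_true_eq, Finset.sum_add_distrib, ih, h2,
      List.length_cons]
    ring

/-- A connected graph with even degrees has an Euler tour. -/
theorem exists_euler_tour [DecidableEq V] [Nonempty V] (L : SimpleGraph V)
    (hconn : ∀ u v, L.Reachable u v) (heven : ∀ v, Even (L.nbrCount v)) :
    ∃ (u : V) (p : L.Walk u u), p.IsTrail ∧ ∀ x y, L.Adj x y → s(x, y) ∈ p.edges := by
  classical
  -- Take a longest trail. It cannot be extended, so it uses every edge at its starting vertex.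
  set S : Set ℕ := {m | ∃ (u w : V) (p : L.Walk u w), p.IsTrail ∧ p.length = m} with hS
  have hbdd : BddAbove S := by
    refine ⟨L.edgeFinset.card, ?_⟩
    rintro _ ⟨u, w, p, hp, rfl⟩
    exact hp.length_le_card_edgeFinset
  have hne : S.Nonempty := ⟨0, Classical.arbitrary V, _, .nil, by simp, rfl⟩
  obtain ⟨u, w, p, hp, hlen⟩ := Nat.sSup_mem hne hbdd
  have hmax : ∀ {a b : V} (q : L.Walk a b), q.IsTrail → q.length ≤ p.length := fun q hq => by
    rw [hlen]; exact le_csSup hbdd ⟨_, _, q, hq, rfl⟩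
  have hstart : ∀ {a b : V} (q : L.Walk a b), q.IsTrail → q.length = p.length →
      ∀ x, L.Adj a x → s(a, x) ∈ q.edges := by
    intro a b q hq hql x hx
    by_contra hno
    have := hmax (.cons hx.symm q) (by rw [Walk.isTrail_cons]; exact ⟨hq, by rwa [Sym2.eq_swap]⟩)
    rw [Walk.length_cons] at this
    omega
  have hcount : ∀ {a b : V} (q : L.Walk a b), q.IsTrail → q.length = p.length →
      q.edges.countP (a ∈ ·) = L.nbrCount a := by
    intro a b q hq hql
    rw [← card_filter_mem_edges _ hq.edges_nodup]
    unfold nbrCount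
    congr 1
    ext x
    simp only [Finset.mem_filter, Finset.mem_univ, true_and]
    exact ⟨fun h => q.adj_of_mem_edges h, hstart q hq hql x⟩
  -- An open trail meets its first vertex an odd number of times, but here that number is the even
  -- degree.
  obtain rfl : u = w := by
    by_contra huw
    have h1 := (hp.even_countP_edges_iff u).1 (by rw [hcount p hp rfl]; exact heven u) huw
    exact h1.1 rfl
  -- A closed trail can be rotated to start at any of its vertices, and it is then again a longest
  -- trail.
  have hsupp : ∀ x ∈ p.support, ∀ y, L.Adj x y → s(x, y) ∈ p.edges := by
    intro x hx y hxy
    have h1 := hstart (p.rotate x hx) (hp.rotate hx) (by simp) y hxy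
    exact (p.rotate_edges x hx).mem_iff.1 h1
  have hall : ∀ x, x ∈ p.support := by
    intro x
    obtain ⟨q⟩ := hconn u x
    have hgo : ∀ {a b : V} (q : L.Walk a b), a ∈ p.support → b ∈ p.support := by
      intro a b q
      induction q with
      | nil => exact id
      | cons h q ih => exact fun ha => ih (p.snd_mem_support_of_mem_edges (hsupp _ ha _ h))
    exact hgo q p.start_mem_support
  exact ⟨u, p, hp, fun x y h => hsupp x (hall x) y h⟩

/-- A connected graph with even degrees and an even number of edges has a spanning subgraph in
which all degrees are halved. -/
theorem exists_half_subgraph [Nonempty V] (L : SimpleGraph V) (hconn : ∀ u v, L.Reachable u v)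
    (heven : ∀ v, Even (L.nbrCount v)) (hsum : 4 ∣ ∑ v, L.nbrCount v) :
    ∃ A : SimpleGraph V, A ≤ L ∧ ∀ v, 2 * A.nbrCount v = L.nbrCount v := by
  classical
  obtain ⟨u, p, hp, hall⟩ := exists_euler_tour L hconn heven
  have hd : ∀ e ∈ p.edges, ¬ e.IsDiag := fun e he =>
    L.not_isDiag_of_mem_edgeSet (p.edges_subset_edgeSet he)
  have hL : ∀ v, L.nbrCount v = p.edges.countP (v ∈ ·) := by
    intro v
    rw [← card_filter_mem_edges _ hp.edges_nodup]
    unfold nbrCount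
    congr 1
    ext x
    simp only [Finset.mem_filter, Finset.mem_univ, true_and]
    exact ⟨fun h => hall v x h, fun h => p.adj_of_mem_edges h⟩
  -- The degree sum is twice the length of the tour.
  have hlen : Even p.length := by
    simp only [hL] at hsum
    rw [sum_countP_mem_edges _ hd, Walk.length_edges] at hsum
    rw [Nat.even_iff]; omega
  have hsub := List.alternate_sublist true p.edges
  let A : SimpleGraph V :=
    { Adj := fun x y => s(x, y) ∈ p.edges.alternate true
      symm := ⟨fun x y h => by rwa [Sym2.eq_swap]⟩
      loopless := ⟨fun x h => hd _ (hsub.subset h) (by simp)⟩ }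
  refine ⟨A, fun x y h => p.adj_of_mem_edges (hsub.subset h), fun v => ?_⟩
  have hA : A.nbrCount v = (p.edges.alternate true).countP (v ∈ ·) := by
    rw [← card_filter_mem_edges _ (hp.edges_nodup.sublist hsub)]
    unfold nbrCount
    congr 1
    ext x
    simp [A]
  have h1 := countP_mem_alternate v p
  have h2 := List.countP_alternate_add (v ∈ ·) p.edges
  rw [hlen.neg_one_pow] at h1
  rw [hL, hA]
  omega

end SimpleGraph

/-! ### Spanning forests of balanced digraphs -/

section BalancedDigraph

variable {V : Type*} [Fintype V]

open Classical in
/-- In a finite digraph with equal in- and outdegrees, reachability is symmetric. -/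
theorem reflTransGen_symm_of_balanced (E : V → V → Prop)
    (hbal : ∀ v, (Finset.univ.filter fun x => E v x).card = (Finset.univ.filter fun x => E x v).card)
    {u v : V} (h : Relation.ReflTransGen E u v) : Relation.ReflTransGen E v u := by
  have hstep : ∀ {u v : V}, E u v → Relation.ReflTransGen E v u := by
    intro u v huv
    -- No arc leaves the set reachable from `v`. By balance none enters it, so the tail `u` of an
    -- arc into `v` belongs to it.
    set S : Finset V := Finset.univ.filter fun w => Relation.ReflTransGen E v w with hS
    have hmem : ∀ w, w ∈ S ↔ Relation.ReflTransGen E v w := fun w => by simp [hS]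
    have hout : ∑ w ∈ S, (Finset.univ.filter fun x => E w x).card =
        ∑ w ∈ S, ∑ x ∈ S, if E w x then 1 else 0 := by
      refine Finset.sum_congr rfl fun w hw => ?_
      rw [Finset.card_filter]
      refine (Finset.sum_subset (Finset.subset_univ S) fun x _ hx => ?_).symm
      rw [if_neg]
      exact fun hwx => hx ((hmem x).2 (((hmem w).1 hw).tail hwx))
    have hin : ∑ w ∈ S, (Finset.univ.filter fun x => E x w).card =
        ∑ w ∈ S, ∑ x, if E x w then 1 else 0 :=
      Finset.sum_congr rfl fun w _ => Finset.card_filter _ _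
    have heq : ∑ w ∈ S, ∑ x, (if E x w then 1 else 0) =
        ∑ w ∈ S, ∑ x ∈ S, if E x w then 1 else 0 := by
      rw [← hin, ← Finset.sum_congr rfl fun w _ => hbal w, hout, Finset.sum_comm]
    by_contra hno
    have hu : u ∉ S := fun hu => hno ((hmem u).1 hu)
    have hv : v ∈ S := (hmem v).2 .refl
    have hlt : ∑ w ∈ S, ∑ x ∈ S, (if E x w then 1 else 0) <
        ∑ w ∈ S, ∑ x, if E x w then 1 else 0 := by
      refine Finset.sum_lt_sum (fun w _ => Finset.sum_le_sum_of_subset (Finset.subset_univ S))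
        ⟨v, hv, ?_⟩
      exact Finset.sum_lt_sum_of_subset (Finset.subset_univ S) (Finset.mem_univ u) hu
        (by rw [if_pos huv]; exact one_pos) fun _ _ _ => Nat.zero_le _
    omega
  induction h with
  | refl => exact .refl
  | tail _ h ih => exact (hstep h).trans ih

open Classical in
/-- A finite digraph with equal in- and outdegrees has a spanning forest whose degrees exceed the
outdegrees by at most one. -/
theorem exists_spanning_forest_of_balanced (E : V → V → Prop) (hirr : ∀ v, ¬ E v v)
    (hbal : ∀ v, (Finset.univ.filter fun x => E v x).card =
      (Finset.univ.filter fun x => E x v).card) :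
    ∃ T : SimpleGraph V, (∀ u v, T.Adj u v → E u v ∨ E v u) ∧
      (∀ u v, E u v → T.Reachable u v) ∧
      ∀ v, T.nbrCount v ≤ (Finset.univ.filter fun x => E v x).card + 1 := by
  let st : Setoid V := ⟨Relation.ReflTransGen E, fun _ => .refl,
    reflTransGen_symm_of_balanced E hbal, Relation.ReflTransGen.trans⟩
  let rt : V → V := fun v => (Quotient.mk st v).out
  have hrt : ∀ v, Relation.ReflTransGen E (rt v) v := fun v => Quotient.mk_out (s := st) v
  have hrt_eq : ∀ {u v}, Relation.ReflTransGen E u v → rt u = rt v := fun {u v} h => by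
    have : Quotient.mk st u = Quotient.mk st v := Quotient.sound h
    simp only [rt, this]
  -- `P m v` says that some walk with `m` arcs leads from a root to `v`. The least such `m` is a
  -- breadth-first level, and each parent lies on a lower level.
  let P : ℕ → V → Prop :=
    Nat.rec (motive := fun _ => V → Prop) (fun v => v = rt v) fun _ Q v => ∃ u, Q u ∧ E u v
  have hP : ∀ v, ∃ m, P m v := by
    intro v
    have hgo : ∀ {a b}, Relation.ReflTransGen E a b → a = rt a → ∃ m, P m b := by
      intro a b h ha
      induction h with
      | refl => exact ⟨0, ha⟩
      | tail _ h ih =>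
        obtain ⟨m, hm⟩ := ih
        exact ⟨m + 1, _, hm, h⟩
    exact hgo (hrt v) (hrt_eq (hrt v)).symm
  have hpar : ∀ v : V, ∃ u : V, v ≠ rt v → E u v ∧ Nat.find (hP u) < Nat.find (hP v) := by
    intro v
    by_cases hv : v = rt v
    · exact ⟨v, fun h => absurd hv h⟩
    have h1 := Nat.find_spec (hP v)
    obtain ⟨m, hm⟩ : ∃ m, Nat.find (hP v) = m + 1 := by
      refine Nat.exists_eq_succ_of_ne_zero fun h0 => hv ?_
      rw [h0] at h1; exact h1
    rw [hm] at h1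
    obtain ⟨u, hu, huv⟩ := h1
    refine ⟨u, fun _ => ⟨huv, ?_⟩⟩
    have := Nat.find_min' (hP u) hu
    omega
  choose par hpar using hpar
  let T : SimpleGraph V :=
    { Adj := fun x y => (x ≠ rt x ∧ par x = y) ∨ (y ≠ rt y ∧ par y = x)
      symm := ⟨fun x y h => h.symm⟩
      loopless := ⟨fun x h => by
        have : ∀ x, ¬ (x ≠ rt x ∧ par x = x) := by
          rintro x ⟨h1, h2⟩
          have := (hpar x h1).1
          rw [h2] at this
          exact hirr x this
        exact h.elim (this x) (this x)⟩ }
  have hreach : ∀ m v, Nat.find (hP v) = m → T.Reachable (rt v) v := by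
    intro m
    induction m using Nat.strong_induction_on with
    | _ m ih =>
      intro v hv
      by_cases hroot : v = rt v
      · rw [← hroot]
      obtain ⟨h1, h2⟩ := hpar v hroot
      have h3 := ih _ (hv ▸ h2) (par v) rfl
      rw [hrt_eq (Relation.ReflTransGen.single h1)] at h3
      exact h3.trans (SimpleGraph.Adj.reachable (Or.inr ⟨hroot, rfl⟩))
  refine ⟨T, ?_, ?_, ?_⟩
  · rintro u v (⟨h, rfl⟩ | ⟨h, rfl⟩)
    · exact Or.inr (hpar u h).1
    · exact Or.inl (hpar v h).1
  · intro u v h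
    have h1 := hreach _ u rfl
    rw [hrt_eq (Relation.ReflTransGen.single h)] at h1
    exact h1.symm.trans (hreach _ v rfl)
  · intro v
    -- The forest neighbours of `v` are its parent and its children, and the children are
    -- out-neighbours.
    refine (Finset.card_le_card (t := insert (par v) (Finset.univ.filter fun x => E v x))
      fun x hx => ?_).trans (Finset.card_insert_le _ _)
    simp only [Finset.mem_filter, Finset.mem_univ, true_and] at hx
    rcases hx with ⟨-, rfl⟩ | ⟨h, rfl⟩
    · exact Finset.mem_insert_self _ _
    · exact Finset.mem_insert_of_mem (by simpa using (hpar x h).1)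

end BalancedDigraph

/-! ### Multiplicity matrices of regular multigraphs and Hamilton cycles -/

section RegularMatrices

variable {V : Type*} [Fintype V]

/-- `M` is the multiplicity matrix of a loopless `d`-regular multigraph in which no two vertices
are joined by more than `m` edges. -/
structure IsRegularMatrix (M : V → V → ℕ) (d m : ℕ) : Prop where
  symm : ∀ u v, M u v = M v u
  diag : ∀ u, M u u = 0
  sum : ∀ u, ∑ v, M u v = d
  le : ∀ u v, M u v ≤ m

open Classical in
/-- `C` is the adjacency matrix of a Hamilton cycle. -/
def IsHamiltonMatrix (C : V → V → ℕ) : Prop :=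
  ∃ w : ℕ → V, Set.InjOn w (Set.Iio (Fintype.card V)) ∧ ∀ u v, C u v =
    if ∃ i < Fintype.card V, (u = w i ∧ v = w ((i + 1) % Fintype.card V)) ∨
      (v = w i ∧ u = w ((i + 1) % Fintype.card V)) then 1 else 0

/-- With at least three vertices the predecessor and the successor of a vertex on the cycle are
distinct, so each row contains exactly two ones. -/
theorem IsHamiltonMatrix.isRegularMatrix {C : V → V → ℕ} (hC : IsHamiltonMatrix C)
    (hn : 3 ≤ Fintype.card V) : IsRegularMatrix C 2 1 := by
  classical
  obtain ⟨w, hw, hC⟩ := hC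
  set n := Fintype.card V with hnd
  have hmod : ∀ i, i % n < n := fun i => Nat.mod_lt _ (by omega)
  have hsucc : ∀ i < n, i ≠ (i + 1) % n := by
    intro i hi
    by_cases h : i + 1 = n
    · rw [h, Nat.mod_self]; omega
    · rw [Nat.mod_eq_of_lt (by omega)]; omega
  refine ⟨fun u v => ?_, fun u => ?_, fun u => ?_, fun u v => ?_⟩
  · rw [hC, hC]
    exact if_congr (exists_congr fun i => and_congr_right fun _ => Or.comm) rfl rfl
  · rw [hC, if_neg]
    rintro ⟨i, hi, ⟨h1, h2⟩ | ⟨h1, h2⟩⟩ <;>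
    exact hsucc i hi (hw (Set.mem_Iio.2 hi) (Set.mem_Iio.2 (hmod _)) (h1.symm.trans h2))
  · obtain ⟨i, hi, rfl⟩ := SimpleGraph.exists_eq_of_injOn hw u
    have hpred : ((i + n - 1) % n + 1) % n = i := by
      rw [Nat.mod_add_mod, Nat.sub_add_cancel (by omega), Nat.add_mod_right, Nat.mod_eq_of_lt hi]
    have : (Finset.univ.filter fun v => ∃ j < n, (w i = w j ∧ v = w ((j + 1) % n)) ∨
        (v = w j ∧ w i = w ((j + 1) % n))) = {w ((i + 1) % n), w ((i + n - 1) % n)} := by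
      ext v
      simp only [Finset.mem_filter, Finset.mem_univ, true_and, Finset.mem_insert,
        Finset.mem_singleton]
      constructor
      · rintro ⟨j, hj, ⟨h1, h2⟩ | ⟨h1, h2⟩⟩
        · left
          rw [hw (Set.mem_Iio.2 hi) (Set.mem_Iio.2 hj) h1, h2]
        · right
          have h3 := hw (Set.mem_Iio.2 hi) (Set.mem_Iio.2 (hmod _)) h2
          rw [h1, h3]
          congr 1
          by_cases h : j + 1 = n
          · rw [h, Nat.mod_self, zero_add, Nat.mod_eq_of_lt (by omega)]; omega
          · rw [Nat.mod_eq_of_lt (by omega : j + 1 < n)]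
            have : j + 1 + n - 1 = j + n := by omega
            rw [this, Nat.add_mod_right, Nat.mod_eq_of_lt hj]
      · rintro (rfl | rfl)
        · exact ⟨i, hi, Or.inl ⟨rfl, rfl⟩⟩
        · exact ⟨(i + n - 1) % n, hmod _, Or.inr ⟨rfl, by rw [hpred]⟩⟩
    simp only [hC]
    rw [← Finset.card_filter, this, Finset.card_pair]
    intro h
    have h1 := hw (Set.mem_Iio.2 (hmod _)) (Set.mem_Iio.2 (hmod _)) h
    by_cases h2 : i + 1 = n
    · have h3 : i + n - 1 = (n - 2) + n := by omega
      rw [h2, Nat.mod_self, h3, Nat.add_mod_right, Nat.mod_eq_of_lt (by omega)] at h1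
      omega
    · rw [Nat.mod_eq_of_lt (by omega)] at h1
      by_cases h0 : i = 0
      · subst h0
        rw [zero_add, zero_add, Nat.mod_eq_of_lt (by omega)] at h1
        omega
      · have h3 : i + n - 1 = (i - 1) + n := by omega
        rw [h3, Nat.add_mod_right, Nat.mod_eq_of_lt (by omega)] at h1
        omega
  · rw [hC]; split_ifs <;> simp

theorem SimpleGraph.HasHamiltonCycle.exists_matrix {H : SimpleGraph V}
    (h : H.HasHamiltonCycle) : ∃ C, IsHamiltonMatrix C ∧ ∀ u v, C u v ≠ 0 → H.Adj u v := by
  classical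
  obtain ⟨w, hw, hadj⟩ := h
  refine ⟨_, ⟨w, hw, fun _ _ => rfl⟩, fun u v huv => ?_⟩
  beta_reduce at huv
  split_ifs at huv with h
  · obtain ⟨i, hi, ⟨rfl, rfl⟩ | ⟨rfl, rfl⟩⟩ := h
    · exact hadj i hi
    · exact (hadj i hi).symm
  · exact absurd rfl huv

/-- Every second edge of a Hamilton cycle on an even number of vertices gives a perfect
matching. -/
theorem IsHamiltonMatrix.exists_perfect_matching {C : V → V → ℕ} (hC : IsHamiltonMatrix C)
    (heven : Even (Fintype.card V)) :
    ∃ P, IsRegularMatrix P 1 1 ∧ ∀ u v, P u v ≤ C u v := by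
  classical
  obtain ⟨w, hw, hC⟩ := hC
  set n := Fintype.card V with hnd
  obtain ⟨h, hh⟩ := heven
  refine ⟨fun u v => if ∃ j < h, (u = w (2 * j) ∧ v = w (2 * j + 1)) ∨
    (v = w (2 * j) ∧ u = w (2 * j + 1)) then 1 else 0, ⟨fun u v => ?_, fun u => ?_, fun u => ?_,
    fun u v => ?_⟩, fun u v => ?_⟩
  · exact if_congr (exists_congr fun i => and_congr_right fun _ => Or.comm) rfl rfl
  · rw [if_neg]
    rintro ⟨i, hi, ⟨h1, h2⟩ | ⟨h1, h2⟩⟩ <;>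
    · have := hw (Set.mem_Iio.2 (by omega)) (Set.mem_Iio.2 (by omega)) (h1.symm.trans h2)
      omega
  · obtain ⟨i, hi, rfl⟩ := SimpleGraph.exists_eq_of_injOn hw u
    have : (Finset.univ.filter fun v => ∃ j < h, (w i = w (2 * j) ∧ v = w (2 * j + 1)) ∨
        (v = w (2 * j) ∧ w i = w (2 * j + 1))) =
        {w (if i % 2 = 0 then i + 1 else i - 1)} := by
      ext v
      simp only [Finset.mem_filter, Finset.mem_univ, true_and, Finset.mem_singleton]
      constructor
      · rintro ⟨j, hj, ⟨h1, h2⟩ | ⟨h1, h2⟩⟩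
        · have h3 := hw (Set.mem_Iio.2 hi) (Set.mem_Iio.2 (by omega)) h1
          rw [h2, if_pos (by omega), h3]
        · have h3 := hw (Set.mem_Iio.2 hi) (Set.mem_Iio.2 (by omega)) h2
          rw [h1, if_neg (by omega), h3]; rfl
      · rintro rfl
        refine ⟨i / 2, by omega, ?_⟩
        split_ifs with h0
        · have : 2 * (i / 2) = i := by omega
          rw [this]; exact Or.inl ⟨rfl, rfl⟩
        · have h1 : 2 * (i / 2) = i - 1 := by omega
          have h2 : i - 1 + 1 = i := by omega
          rw [h1, h2]; exact Or.inr ⟨rfl, rfl⟩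
    rw [← Finset.card_filter, this, Finset.card_singleton]
  · split_ifs <;> simp
  · beta_reduce
    split_ifs with hj
    · obtain ⟨j, hj, h1⟩ := hj
      rw [hC, if_pos]
      exact ⟨2 * j, by omega, by rwa [Nat.mod_eq_of_lt (by omega)]⟩
    · exact Nat.zero_le _

end RegularMatrices

/-! ### Splitting a balanced zero-one matrix into a Hamilton cycle and two simple graphs -/

section Split

variable {V : Type*} [Fintype V]

theorem SimpleGraph.even_sum_nbrCount (H : SimpleGraph V) : Even (∑ v, H.nbrCount v) := by
  classical
  have h := H.sum_degrees_eq_twice_card_edges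
  have h2 : ∑ v, H.nbrCount v = ∑ v, H.degree v := by
    refine Finset.sum_congr rfl fun v _ => ?_
    rw [← H.card_neighborFinset_eq_degree, H.neighborFinset_eq_filter]
    unfold nbrCount
    congr
  rw [h2, h]
  exact even_two_mul _

/-- A regular multigraph of multiplicity at most two on an even number of vertices, whose support
is connected through its simple edges, splits evenly into two simple graphs. -/
theorem exists_split_of_connected (Y : V → V → ℕ) (d : ℕ) (hY : IsRegularMatrix Y (2 * d) 2)
    (heven : Even (Fintype.card V)) (L : SimpleGraph V) (hL : ∀ u v, L.Adj u v ↔ Y u v = 1)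
    (hconn : ∀ u v, L.Reachable u v) :
    ∃ A B : V → V → ℕ, IsRegularMatrix A d 1 ∧ IsRegularMatrix B d 1 ∧
      ∀ u v, A u v + B u v = Y u v := by
  classical
  rcases isEmpty_or_nonempty V with hV | hV
  · exact ⟨Y, Y, ⟨fun u => isEmptyElim u, fun u => isEmptyElim u, fun u => isEmptyElim u,
      fun u => isEmptyElim u⟩, ⟨fun u => isEmptyElim u, fun u => isEmptyElim u,
      fun u => isEmptyElim u, fun u => isEmptyElim u⟩, fun u => isEmptyElim u⟩
  let D : SimpleGraph V :=
    { Adj := fun u v => Y u v = 2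
      symm := ⟨fun u v h => by rwa [hY.symm]⟩
      loopless := ⟨fun u h => by rw [hY.diag] at h; omega⟩ }
  have hY3 : ∀ u v, Y u v = 0 ∨ Y u v = 1 ∨ Y u v = 2 := fun u v => by
    have := hY.le u v; omega
  have hcount : ∀ v, L.nbrCount v + 2 * D.nbrCount v = 2 * d := by
    intro v
    rw [← hY.sum v]
    unfold SimpleGraph.nbrCount
    rw [Finset.card_filter, Finset.card_filter, Finset.mul_sum, ← Finset.sum_add_distrib]
    refine Finset.sum_congr rfl fun x _ => ?_
    have e : D.Adj v x ↔ Y v x = 2 := Iff.rfl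
    simp only [hL, e]
    rcases hY3 v x with h | h | h <;> rw [h] <;> simp
  -- The degrees of `L` and twice those of `D` add up to `|V| * (2 * d)`, a multiple of 4 as `|V|`
  -- is even. The degree sum of `D` is even, so that of `L` is divisible by 4.
  obtain ⟨A₀, hA₀, hhalf⟩ := L.exists_half_subgraph hconn
    (fun v => by have := hcount v; rw [Nat.even_iff]; omega) (by
      have h1 : ∑ v, L.nbrCount v + 2 * ∑ v, D.nbrCount v = Fintype.card V * (2 * d) := by
        rw [Finset.mul_sum, ← Finset.sum_add_distrib, Finset.sum_congr rfl fun v _ => hcount v]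
        simp
      obtain ⟨a, ha⟩ := D.even_sum_nbrCount
      obtain ⟨b, hb⟩ := heven
      rw [hb, ha] at h1
      have h2 : (b + b) * (2 * d) = 4 * (b * d) := by ring
      rw [h2] at h1
      omega)
  have hA₀Y : ∀ u v, A₀.Adj u v → Y u v = 1 := fun u v h => (hL u v).1 (hA₀ h)
  -- One copy of each double edge and half of the simple edges.
  set A : V → V → ℕ := fun u v => (if A₀.Adj u v then 1 else 0) + if Y u v = 2 then 1 else 0
    with hA
  have hAle : ∀ u v, A u v ≤ 1 ∧ A u v ≤ Y u v ∧ Y u v - A u v ≤ 1 := by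
    intro u v
    simp only [hA]
    by_cases h : A₀.Adj u v
    · simp [h, hA₀Y u v h]
    · rcases hY3 u v with h' | h' | h' <;> simp [h, h']
  have hAsum : ∀ u, ∑ v, A u v = d := by
    intro u
    simp only [hA, Finset.sum_add_distrib, ← Finset.card_filter]
    have h1 := hhalf u
    have h2 := hcount u
    have e1 : (Finset.univ.filter fun v => A₀.Adj u v).card = A₀.nbrCount u := by
      unfold SimpleGraph.nbrCount; congr
    have e2 : (Finset.univ.filter fun v => Y u v = 2).card = D.nbrCount u := by
      unfold SimpleGraph.nbrCount; congr
    rw [e1, e2]; omega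
  refine ⟨A, fun u v => Y u v - A u v, ⟨fun u v => ?_, fun u => ?_, hAsum, fun u v => (hAle u v).1⟩,
    ⟨fun u v => ?_, fun u => ?_, fun u => ?_, fun u v => (hAle u v).2.2⟩, fun u v => ?_⟩
  · simp only [hA, A₀.adj_comm u v, hY.symm u v]
  · have := (hAle u u).2.1; rw [hY.diag] at this; omega
  · simp only [hA, A₀.adj_comm u v, hY.symm u v]
  · rw [hY.diag, Nat.zero_sub]
  · rw [Finset.sum_tsub_distrib _ fun v _ => (hAle u v).2.1, hY.sum, hAsum]; omega
  · have := (hAle u v).2.1; dsimp only; omega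

open Classical in
/-- Let the multigraph `y + yᵀ` be given by a balanced zero-one matrix `y`. It decomposes into a
Hamilton cycle avoiding a given set of double edges and two regular simple graphs, provided that
few vertices meet many of the double edges to be avoided. -/
theorem exists_hamilton_split (y : V → V → ℕ) (d : ℕ) (hle : ∀ u v, y u v ≤ 1)
    (hdiag : ∀ u, y u u = 0) (hrow : ∀ u, ∑ v, y u v = d + 1) (hcol : ∀ v, ∑ u, y u v = d + 1)
    (hn : 3 ≤ Fintype.card V) (heven : Even (Fintype.card V))
    (bad : V → V → Prop) (hbsymm : ∀ u v, bad u v → bad v u)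
    (hbad : ∀ u v, bad u v → y u v = 1)
    (hposa : ∀ k, 1 ≤ k → 2 * k < Fintype.card V →
      {v | d ≤ k + (Finset.univ.filter fun x => bad v x).card}.ncard < k) :
    ∃ C A B : V → V → ℕ, IsHamiltonMatrix C ∧ IsRegularMatrix A d 1 ∧ IsRegularMatrix B d 1 ∧
      (∀ u v, C u v + A u v + B u v = y u v + y v u) ∧ ∀ u v, bad u v → C u v = 0 := by
  have hy01 : ∀ u v, y u v = 0 ∨ y u v = 1 := fun u v => by have := hle u v; omega
  have hrowc : ∀ u, (Finset.univ.filter fun v => y u v = 1).card = d + 1 := by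
    intro u
    rw [← hrow u, Finset.card_filter]
    refine Finset.sum_congr rfl fun v _ => ?_
    rcases hy01 u v with h | h <;> simp [h]
  have hcolc : ∀ u, (Finset.univ.filter fun v => y v u = 1).card = d + 1 := by
    intro u
    rw [← hcol u, Finset.card_filter]
    refine Finset.sum_congr rfl fun v _ => ?_
    rcases hy01 v u with h | h <;> simp [h]
  obtain ⟨E, hE⟩ : ∃ E : V → V → Prop, ∀ u v, E u v ↔ y u v = 1 ∧ y v u = 0 :=
    ⟨_, fun _ _ => Iff.rfl⟩
  have hE1 : ∀ u, (Finset.univ.filter fun v => y u v = 1 ∧ y v u = 1).card +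
      (Finset.univ.filter fun v => E u v).card = d + 1 := by
    intro u
    rw [← hrowc u, ← Finset.card_union_of_disjoint]
    · congr 1
      ext v
      rcases hy01 v u with h | h <;> simp [hE, h]
    · rw [Finset.disjoint_left]
      intro v h1 h2
      simp only [Finset.mem_filter, Finset.mem_univ, true_and, hE] at h1 h2
      omega
  have hE2 : ∀ u, (Finset.univ.filter fun v => y u v = 1 ∧ y v u = 1).card +
      (Finset.univ.filter fun v => E v u).card = d + 1 := by
    intro u
    rw [← hcolc u, ← Finset.card_union_of_disjoint]
    · congr 1
      ext v
      rcases hy01 u v with h | h <;> simp [hE, h]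
    · rw [Finset.disjoint_left]
      intro v h1 h2
      simp only [Finset.mem_filter, Finset.mem_univ, true_and, hE] at h1 h2
      omega
  -- The one-way arcs `E` form a balanced digraph. Its forest `T` is withheld from the Hamilton
  -- cycle so that connectivity survives.
  obtain ⟨T, hTE, hTreach, hTdeg⟩ := exists_spanning_forest_of_balanced E
    (fun v h => by have := (hE v v).1 h; omega)
    (fun v => by have := hE1 v; have := hE2 v; omega)
  obtain ⟨U, hU⟩ : ∃ U : SimpleGraph V, ∀ u v, U.Adj u v ↔
      (y u v = 1 ∧ y v u = 1 ∧ ¬ bad u v) ∨ ((E u v ∨ E v u) ∧ ¬ T.Adj u v) :=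
    ⟨{ Adj := fun u v => (y u v = 1 ∧ y v u = 1 ∧ ¬ bad u v) ∨ ((E u v ∨ E v u) ∧ ¬ T.Adj u v)
       symm := ⟨fun u v h => by
        rcases h with ⟨h1, h2, h3⟩ | ⟨h1, h2⟩
        · exact Or.inl ⟨h2, h1, fun h => h3 (hbsymm _ _ h)⟩
        · exact Or.inr ⟨h1.symm, fun h => h2 h.symm⟩⟩
       loopless := ⟨fun u h => by have := hdiag u; simp only [hE] at h; omega⟩ },
      fun _ _ => Iff.rfl⟩
  -- A vertex has `d + 1` in-neighbours and, disjoint from them, its one-way out-neighbours. The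
  -- forest removes at most one more than the number of the latter, leaving `d` apart from the bad
  -- pairs.
  have hUdeg : ∀ v, d ≤ U.nbrCount v + (Finset.univ.filter fun x => bad v x).card := by
    intro v
    have h1 : (Finset.univ.filter fun x => y x v = 1) ∪ (Finset.univ.filter fun x => E v x) ⊆
        ((Finset.univ.filter fun x => U.Adj v x) ∪ (Finset.univ.filter fun x => bad v x)) ∪
          (Finset.univ.filter fun x => T.Adj v x) := by
      intro x hx
      have h1 := hy01 v x
      have h2 := hy01 x v
      simp only [Finset.mem_union, Finset.mem_filter, Finset.mem_univ, true_and, hU, hE] at hx ⊢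
      by_cases h3 : bad v x <;> by_cases h4 : T.Adj v x <;> simp only [h3, h4] <;> simp <;> omega
    have h2 : Disjoint (Finset.univ.filter fun x => y x v = 1)
        (Finset.univ.filter fun x => E v x) := by
      rw [Finset.disjoint_left]
      intro x h1 h2
      simp only [Finset.mem_filter, Finset.mem_univ, true_and, hE] at h1 h2
      omega
    have h3 := Finset.card_le_card h1
    rw [Finset.card_union_of_disjoint h2, hcolc] at h3
    have h4 := Finset.card_union_le
      ((Finset.univ.filter fun x => U.Adj v x) ∪ (Finset.univ.filter fun x => bad v x))
      (Finset.univ.filter fun x => T.Adj v x)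
    have h5 := Finset.card_union_le
      (Finset.univ.filter fun x => U.Adj v x) (Finset.univ.filter fun x => bad v x)
    have h6 := hTdeg v
    unfold SimpleGraph.nbrCount at h6 ⊢
    omega
  have hUham : U.HasHamiltonCycle := by
    refine U.hasHamiltonCycle_of_posa hn fun k h1 h2 => ?_
    refine lt_of_le_of_lt (Set.ncard_le_ncard (fun v hv => ?_) (Set.toFinite _)) (hposa k h1 h2)
    have h3 := hUdeg v
    have h4 : U.nbrCount v ≤ k := hv
    change d ≤ _
    omega
  obtain ⟨C, hC, hCU⟩ := hUham.exists_matrix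
  have hCreg := hC.isRegularMatrix hn
  have hCle : ∀ u v, C u v ≤ y u v + y v u := by
    intro u v
    by_cases h : C u v = 0
    · omega
    · have h1 := hCreg.le u v
      have h2 := hCU u v h
      simp only [hU, hE] at h2
      omega
  set Y : V → V → ℕ := fun u v => y u v + y v u - C u v with hYdef
  have hY : IsRegularMatrix Y (2 * d) 2 := by
    refine ⟨fun u v => ?_, fun u => ?_, fun u => ?_, fun u v => ?_⟩
    · simp only [hYdef]; rw [hCreg.symm u v, add_comm]
    · simp [hYdef, hdiag]
    · simp only [hYdef]
      rw [Finset.sum_tsub_distrib _ fun v _ => hCle u v, Finset.sum_add_distrib, hrow, hcol,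
        hCreg.sum]
      omega
    · have := hle u v; have := hle v u; simp only [hYdef]; omega
  let L : SimpleGraph V :=
    { Adj := fun u v => Y u v = 1
      symm := ⟨fun u v h => by rwa [hY.symm]⟩
      loopless := ⟨fun u h => by rw [hY.diag] at h; omega⟩ }
  have hTL : T ≤ L := by
    intro u v huv
    have h1 := hTE u v huv
    simp only [hE] at h1
    have h2 : C u v = 0 := by
      by_contra h
      have h2 := hCU u v h
      simp only [hU, huv, not_true, and_false, or_false] at h2
      omega
    change y u v + y v u - C u v = 1
    omega
  -- A double edge used by `C` becomes simple, and the ends of a one-way edge used by `C` are joined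
  -- through `T`. So `L` connects consecutive vertices of the Hamilton cycle, hence all vertices.
  have hCL : ∀ u v, C u v = 1 → L.Reachable u v := by
    intro u v huv
    have h1 := (hU u v).1 (hCU u v (by omega))
    rcases h1 with ⟨h1, h2, -⟩ | ⟨h1, -⟩
    · refine SimpleGraph.Adj.reachable ?_
      change y u v + y v u - C u v = 1
      omega
    · rcases h1 with h1 | h1
      · exact (hTreach _ _ h1).mono hTL
      · exact ((hTreach _ _ h1).mono hTL).symm
  have hconn : ∀ u v, L.Reachable u v := by
    obtain ⟨w, hw, hCw⟩ := hC
    have h0 : ∀ i < Fintype.card V, L.Reachable (w 0) (w i) := by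
      intro i
      induction i with
      | zero => exact fun _ => .rfl
      | succ i ih =>
        intro hi
        refine (ih (by omega)).trans (hCL _ _ ?_)
        rw [hCw, if_pos]
        exact ⟨i, by omega, Or.inl ⟨rfl, by rw [Nat.mod_eq_of_lt hi]⟩⟩
    intro u v
    obtain ⟨i, hi, rfl⟩ := SimpleGraph.exists_eq_of_injOn hw u
    obtain ⟨j, hj, rfl⟩ := SimpleGraph.exists_eq_of_injOn hw v
    exact (h0 i hi).symm.trans (h0 j hj)
  obtain ⟨A, B, hA, hB, hAB⟩ := exists_split_of_connected Y d hY heven L (fun _ _ => Iff.rfl) hconn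
  refine ⟨C, A, B, hC, hA, hB, fun u v => ?_, fun u v hb => ?_⟩
  · have h1 := hAB u v
    have h2 := hCle u v
    simp only [hYdef] at h1
    omega
  · by_contra h
    have h1 := hCU u v h
    have h2 := hbad u v hb
    have h3 := hbad v u (hbsymm u v hb)
    simp only [hU, hE, hb, not_true, and_false, false_or] at h1
    omega

end Split

/-! ### Decomposing the multiplicity matrix -/

section MatrixDecomposition

variable {V : Type*} [Fintype V]

open Classical in
/-- A regular multigraph of high degree contains a Hamilton cycle and an edge-disjoint regular
simple graph such that their removal lowers the maximum multiplicity. -/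
theorem IsRegularMatrix.exists_hamilton_add_simple [LinearOrder V] {μ : V → V → ℕ} {r s : ℕ}
    (hμ : IsRegularMatrix μ (r * s) r) (hr : 2 ≤ r) (heven : Even (Fintype.card V))
    (hn : 96 ≤ Fintype.card V) (hs : Fintype.card V + 32 ≤ 2 * s) :
    ∃ C A : V → V → ℕ, IsHamiltonMatrix C ∧ IsRegularMatrix A (s - 1) 1 ∧
      (∀ u v, C u v + A u v ≤ μ u v) ∧ ∀ u v, μ u v ≤ C u v + A u v + (r - 1) := by
  obtain ⟨h, hh⟩ := heven
  have hr0 : (0 : ℝ) < r := by exact_mod_cast (by omega : 0 < r)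
  obtain ⟨x, N, hN, hxx, hxs, hxne, hx1, hxN⟩ := exists_tight_orientation μ r s (by omega)
    hμ.symm hμ.diag hμ.sum
  have hx0 : ∀ u v, 0 ≤ x u v := by
    intro u v
    by_cases h1 : μ u v = 1
    · exact (hx1 u v h1).1
    · rw [hxne u v h1]; positivity
  have hxcol : ∀ v, ∑ u, x u v = s := by
    intro v
    have h1 : ∀ u, x u v = 2 * μ v u / r - x v u := fun u => by
      rw [← hxx v u]; ring
    have h2 : ∑ u, (μ v u : ℝ) = r * s := by exact_mod_cast hμ.sum v
    rw [Finset.sum_congr rfl fun u _ => h1 u, Finset.sum_sub_distrib, hxs, ← Finset.sum_div,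
      ← Finset.mul_sum, h2]
    field_simp; ring
  obtain ⟨y, hy, hyrow, hycol⟩ := exists_rounded_matrix x s hx0 hxs hxcol
  have hxle : ∀ u v, x u v ≤ 1 := by
    intro u v
    by_cases h1 : μ u v = 1
    · refine (hx1 u v h1).2.trans ?_
      rw [div_le_one hr0]; exact_mod_cast hr
    · rw [hxne u v h1, div_le_one hr0]; exact_mod_cast hμ.le u v
  have hyle : ∀ u v, y u v ≤ 1 := by
    intro u v
    have h1 : ⌈x u v⌉ ≤ 1 := Int.ceil_le.2 (by simpa using hxle u v)
    exact_mod_cast (hy u v).2.trans h1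
  have hyfull : ∀ u v, μ u v = r → y u v = 1 := by
    intro u v h1
    have h2 : x u v = 1 := by rw [hxne u v (by omega), h1]; field_simp
    have h3 := (hy u v).1
    rw [h2] at h3
    simp at h3
    have := hyle u v
    omega
  have hyzero : ∀ u v, μ u v = 0 → y u v = 0 := by
    intro u v h1
    have h2 : x u v = 0 := by rw [hxne u v (by omega), h1]; simp
    have h3 := (hy u v).2
    rw [h2] at h3
    simpa using h3
  have hypos : ∀ u v, y u v = 1 → 0 < x u v := by
    intro u v h1
    have h2 := (hy u v).2
    rw [h1] at h2
    exact Int.ceil_pos.1 (by push_cast at h2; omega)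
  -- At these pairs `y + yᵀ` exceeds `μ`, so `C` must avoid them. Both directions must have positive
  -- weight in `x`, which makes them non-extreme arcs of the basic solution.
  obtain ⟨bad, hbad⟩ : ∃ bad : V → V → Prop, ∀ u v, bad u v ↔
      μ u v = 1 ∧ y u v = 1 ∧ y v u = 1 := ⟨_, fun _ _ => Iff.rfl⟩
  set b : V → ℕ := fun v => (Finset.univ.filter fun u => bad v u).card with hb
  have hbsum : ∑ v, b v ≤ 2 * Fintype.card V := by
    have h1 : ∑ v, b v = (Finset.univ.filter fun i : V × V => bad i.1 i.2).card := by
      simp only [hb, Finset.card_filter]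
      rw [Fintype.sum_prod_type]
    have h2 : (Finset.univ.filter fun i : V × V => bad i.1 i.2) ⊆ N ∪ N.image Prod.swap := by
      intro i hi
      simp only [Finset.mem_filter, Finset.mem_univ, true_and, hbad] at hi
      rcases hxN i.1 i.2 hi.1 (hypos _ _ hi.2.1) (hypos _ _ hi.2.2) with h | h
      · exact Finset.mem_union_left _ h
      · exact Finset.mem_union_right _ (Finset.mem_image.2 ⟨_, h, rfl⟩)
    have h3 := Finset.card_le_card h2
    have h4 := Finset.card_union_le N (N.image Prod.swap)
    have h5 : (N.image Prod.swap).card ≤ N.card := Finset.card_image_le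
    omega
  -- Summing the inequality `h1` over `u` gives `(r - 1) * (b v + s) ≤ (r - 1) * |V|`.
  have hbmax : ∀ v, b v + s ≤ Fintype.card V := by
    intro v
    have h1 : ∀ u, 2 * μ v u + 2 * (r - 1) * (if bad v u then 1 else 0) ≤
        2 * (r - 1) + (y v u + y u v) := by
      intro u
      split_ifs with h
      · rw [hbad] at h; omega
      · by_cases h2 : μ v u = r
        · have h3 := hyfull v u h2
          have h4 := hyfull u v (by rw [hμ.symm]; exact h2)
          omega
        · have := hμ.le v u; omega
    have h2 := Finset.sum_le_sum fun u (_ : u ∈ Finset.univ) => h1 u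
    simp only [Finset.sum_add_distrib, ← Finset.mul_sum, hμ.sum, ← Finset.card_filter, hyrow,
      hycol, Finset.sum_const, Finset.card_univ, smul_eq_mul] at h2
    obtain ⟨q, rfl⟩ : ∃ q, r = q + 1 := ⟨r - 1, by omega⟩
    simp only [Nat.add_sub_cancel] at h2
    have h3 : q * (b v + s) ≤ q * Fintype.card V := by
      change 2 * ((q + 1) * s) + 2 * q * b v ≤ _ at h2
      nlinarith
    exact Nat.le_of_mul_le_mul_left h3 (by omega)
  obtain ⟨C, A, B, hC, hA, hB, hsum, hCbad⟩ := exists_hamilton_split y (s - 1) hyle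
    (fun u => hyzero u u (hμ.diag u)) (fun u => by rw [hyrow]; omega)
    (fun u => by rw [hycol]; omega) (by omega) ⟨h, hh⟩ bad
    (fun u v h => by rw [hbad] at h ⊢; rw [hμ.symm v u]; tauto)
    (fun u v h => ((hbad u v).1 h).2.1) (by
      intro k hk1 hk2
      by_contra hlt
      have h1 : {v | s - 1 ≤ k + b v}.ncard =
          (Finset.univ.filter fun v => s - 1 ≤ k + b v).card := by
        rw [← Set.ncard_coe_finset]; simp
      change ¬ {v | s - 1 ≤ k + b v}.ncard < k at hlt
      rw [h1, not_lt] at hlt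
      obtain ⟨v, hv⟩ := Finset.card_pos.1 (by omega : 0 <
        (Finset.univ.filter fun v => s - 1 ≤ k + b v).card)
      have hv' := (Finset.mem_filter.1 hv).2
      have hv2 := hbmax v
      have h3 : k * (s - 1 - k) ≤ ∑ v, b v := by
        calc k * (s - 1 - k)
            ≤ (Finset.univ.filter fun v => s - 1 ≤ k + b v).card * (s - 1 - k) :=
              Nat.mul_le_mul_right _ hlt
          _ ≤ ∑ v ∈ Finset.univ.filter fun v => s - 1 ≤ k + b v, b v := by
              rw [← smul_eq_mul]
              refine Finset.card_nsmul_le_sum _ _ _ fun v hv => ?_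
              have := (Finset.mem_filter.1 hv).2
              omega
          _ ≤ _ := Finset.sum_le_sum_of_subset (Finset.filter_subset _ _)
      -- Here `|V| = 2 * h` and `s ≥ h + 16`, while the numbers `b v` sum to at most `4 * h`.
      have h4 : k * (h + 15 - k) ≤ 4 * h := by
        have : k * (h + 15 - k) ≤ k * (s - 1 - k) := Nat.mul_le_mul_left _ (by omega)
        omega
      obtain ⟨i, hi⟩ : ∃ i, h = k + 1 + i := ⟨h - k - 1, by omega⟩
      -- A single vertex of the set gives `s - 1 ≤ k + (|V| - s)`, hence `k ≥ 31`. Together with `k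
      -- < h` this makes `k * (h + 15 - k)` larger than `4 * h`.
      obtain ⟨j, hj⟩ : ∃ j, k = 31 + j := ⟨k - 31, by omega⟩
      have h5 : h + 15 - k = 16 + i := by omega
      rw [h5, hj] at h4
      nlinarith [Nat.zero_le (i * j)])
  -- At a bad pair `C` vanishes and `A` contributes at most one. At a pair of multiplicity `r` the
  -- total is two and `B` takes at most one.
  refine ⟨C, A, hC, hA, fun u v => ?_, fun u v => ?_⟩
  · have h1 := hsum u v
    have h2 := hyle u v
    have h3 := hyle v u
    have h4 := hA.le u v
    by_cases h0 : μ u v = 0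
    · have := hyzero u v h0
      have := hyzero v u (by rw [hμ.symm]; exact h0)
      omega
    · by_cases h5 : bad u v
      · have := hCbad u v h5; omega
      · rw [hbad] at h5; omega
  · have h1 := hsum u v
    have h2 := hB.le u v
    by_cases h0 : μ u v = r
    · have := hyfull u v h0
      have := hyfull v u (by rw [hμ.symm]; exact h0)
      omega
    · have := hμ.le u v; omega

theorem IsRegularMatrix.sub {M P : V → V → ℕ} {D d m m' : ℕ} (hM : IsRegularMatrix M D m)
    (hP : IsRegularMatrix P d m') (hle : ∀ u v, P u v ≤ M u v) :
    IsRegularMatrix (fun u v => M u v - P u v) (D - d) m where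
  symm u v := by rw [hM.symm, hP.symm]
  diag u := by simp [hM.diag]
  sum u := by rw [Finset.sum_tsub_distrib _ fun v _ => hle u v, hM.sum, hP.sum]
  le u v := (Nat.sub_le _ _).trans (hM.le u v)

/-- A regular multigraph of high degree on an even number of vertices has a perfect matching. -/
theorem IsRegularMatrix.exists_perfect_matching {M : V → V → ℕ} {D m h : ℕ}
    (hM : IsRegularMatrix M D m) (hh : Fintype.card V = 2 * h) (hh2 : 2 ≤ h)
    (hD : m * (h - 1) < D) :
    ∃ P, IsRegularMatrix P 1 1 ∧ ∀ u v, P u v ≤ M u v := by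
  classical
  obtain ⟨H, hH⟩ : ∃ H : SimpleGraph V, ∀ u v, H.Adj u v ↔ M u v ≠ 0 :=
    ⟨{ Adj := fun u v => M u v ≠ 0
       symm := ⟨fun u v h => by rwa [hM.symm]⟩
       loopless := ⟨fun u h => h (hM.diag u)⟩ }, fun _ _ => Iff.rfl⟩
  have hdeg : ∀ v, h ≤ H.nbrCount v := by
    intro v
    -- With at most `m` edges to each neighbour, fewer than `h` neighbours could not account for the
    -- degree `D`.
    by_contra hlt
    have h1 : D ≤ m * H.nbrCount v := by
      rw [← hM.sum v]
      unfold SimpleGraph.nbrCount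
      rw [mul_comm, ← smul_eq_mul, ← Finset.sum_const, Finset.sum_filter]
      refine Finset.sum_le_sum fun u _ => ?_
      rw [hH]
      split_ifs with h0
      · exact hM.le v u
      · omega
    have h2 : m * H.nbrCount v ≤ m * (h - 1) := Nat.mul_le_mul_left _ (by omega)
    omega
  obtain ⟨C, hC, hCH⟩ := (H.hasHamiltonCycle_of_dirac (by omega)
    (fun v => by have := hdeg v; omega)).exists_matrix
  obtain ⟨P, hP, hPC⟩ := hC.exists_perfect_matching ⟨h, by omega⟩
  refine ⟨P, hP, fun u v => (hPC u v).trans ?_⟩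
  have h1 := (hC.isRegularMatrix (by omega)).le u v
  by_cases h0 : C u v = 0
  · omega
  · have := (hH u v).1 (hCH u v h0); omega

theorem IsRegularMatrix.exists_perfect_matchings {m h : ℕ}
    (hh : Fintype.card V = 2 * h) (hh2 : 2 ≤ h) : ∀ (j : ℕ) {M : V → V → ℕ} {D : ℕ},
    IsRegularMatrix M D m → m * (h - 1) + j ≤ D →
    ∃ (P : Fin j → V → V → ℕ) (R : V → V → ℕ), (∀ i, IsRegularMatrix (P i) 1 1) ∧
      IsRegularMatrix R (D - j) m ∧ ∀ u v, ∑ i, P i u v + R u v = M u v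
  | 0, M, D, hM, _ => ⟨fun i => i.elim0, M, fun i => i.elim0, by simpa using hM, by simp⟩
  | j + 1, M, D, hM, hD => by
    obtain ⟨P₀, hP₀, hle⟩ := hM.exists_perfect_matching hh hh2 (by omega)
    obtain ⟨P, R, hP, hR, hsum⟩ := exists_perfect_matchings hh hh2 j (hM.sub hP₀ hle) (by omega)
    refine ⟨Fin.cons P₀ P, R, fun i => ?_, ?_, fun u v => ?_⟩
    · refine Fin.cases ?_ (fun i => ?_) i
      · simpa using hP₀
      · simpa using hP i
    · rwa [Nat.sub_sub, add_comm 1 j] at hR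
    · rw [Fin.sum_univ_succ]
      have h1 := hsum u v
      have h2 := hle u v
      simp only [Fin.cons_zero, Fin.cons_succ]
      omega

/-- A regular multigraph of even maximum multiplicity `2 * t` and high degree decomposes into `t`
Hamilton cycles and `2 * t` regular simple graphs. -/
theorem IsRegularMatrix.exists_hamilton_decomposition [LinearOrder V] {R : V → V → ℕ} {t d : ℕ}
    (hR : IsRegularMatrix R (2 * (t * (d + 1))) (2 * t)) (heven : Even (Fintype.card V))
    (hn : 3 ≤ Fintype.card V) (hd : Fintype.card V ≤ 2 * d) :
    ∃ C A B : Fin t → V → V → ℕ, (∀ i, IsHamiltonMatrix (C i)) ∧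
      (∀ i, IsRegularMatrix (A i) d 1) ∧ (∀ i, IsRegularMatrix (B i) d 1) ∧
      ∀ u v, ∑ i, (C i u v + A i u v + B i u v) = R u v := by
  obtain ⟨a, ha, hale, hasum⟩ := exists_balanced_orientation R _ hR.symm hR.diag hR.sum
  have hacol : ∀ v, ∑ u, a u v = t * (d + 1) := by
    intro v
    have h1 : ∑ u, a u v + ∑ u, a v u = 2 * (t * (d + 1)) := by
      rw [← hR.sum v, ← Finset.sum_add_distrib]
      exact Finset.sum_congr rfl fun u _ => by rw [add_comm, ha]
    rw [hasum] at h1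
    omega
  -- Evenness of the multiplicity bound enters here: half of `2 * t`, rounded up, is still `t`.
  obtain ⟨y, hyle, hyrow, hycol, hysum⟩ := exists_zero_one_decomposition (d + 1) t a
    (fun u v => by have := hale u v; have := hR.le u v; omega) hasum hacol
  have hydiag : ∀ i u, y i u u = 0 := by
    intro i u
    have h1 : y i u u ≤ ∑ i, y i u u :=
      Finset.single_le_sum (f := fun i => y i u u) (fun _ _ => Nat.zero_le _) (Finset.mem_univ i)
    have h2 := hale u u
    rw [hR.diag] at h2
    rw [hysum] at h1
    omega
  have hex := fun i => exists_hamilton_split (y i) d (hyle i) (hydiag i) (hyrow i) (hycol i) hn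
    heven (fun _ _ => False) (fun _ _ h => h) (fun _ _ h => h.elim) (by
      intro k hk1 hk2
      refine lt_of_eq_of_lt ((Set.ncard_eq_zero (Set.toFinite _)).2 ?_) hk1
      ext v
      simp only [Finset.filter_false, Finset.card_empty, Set.mem_ofPred_eq,
        Set.mem_empty_iff_false, iff_false]
      omega)
  choose C A B hC hA hB hsum _ using hex
  refine ⟨C, A, B, hC, hA, hB, fun u v => ?_⟩
  rw [Finset.sum_congr rfl fun i _ => hsum i u v, Finset.sum_add_distrib, hysum, hysum, ha]

/-- The multiplicity matrix `μ` is the sum of those of `p` perfect matchings, `h` Hamilton cycles,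
a `d₁`-regular simple graph and `q` simple graphs which are `d₂`-regular. -/
def MatrixDecomposesInto (μ : V → V → ℕ) (p h d₁ q d₂ : ℕ) : Prop :=
  ∃ (P : Fin p → V → V → ℕ) (C : Fin h → V → V → ℕ) (S : V → V → ℕ) (T : Fin q → V → V → ℕ),
    (∀ i, IsRegularMatrix (P i) 1 1) ∧ (∀ i, IsHamiltonMatrix (C i)) ∧ IsRegularMatrix S d₁ 1 ∧
    (∀ i, IsRegularMatrix (T i) d₂ 1) ∧
    ∀ u v, ∑ i, P i u v + (∑ i, C i u v + (S u v + ∑ i, T i u v)) = μ u v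

/-- With `r = 2 * t + 1` and `s = d + 2`, removing a Hamilton cycle and an `(s - 1)`-regular simple
graph leaves multiplicity at most `2 * t` and degree `2 * t * (d + 1) + (2 * t - 1)`. The excess is
taken up by `2 * t - 1` perfect matchings, and the even case handles the rest. -/
theorem IsRegularMatrix.matrixDecomposesInto [LinearOrder V] {μ : V → V → ℕ} {r s : ℕ}
    (hμ : IsRegularMatrix μ (r * s) r) (hr : 3 ≤ r) (hodd : Odd r) (heven : Even (Fintype.card V))
    (hn : 96 ≤ Fintype.card V) (hs : Fintype.card V + 32 ≤ 2 * s) :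
    MatrixDecomposesInto μ (r - 2) ((r + 1) / 2) (s - 1) (r - 1) (s - 2) := by
  obtain ⟨C₀, S, hC₀, hS, hle, hge⟩ := hμ.exists_hamilton_add_simple (by omega) heven hn hs
  obtain ⟨h, hh⟩ := heven
  obtain ⟨t, rfl⟩ := hodd
  obtain ⟨d, rfl⟩ : ∃ d, s = d + 2 := ⟨s - 2, by omega⟩
  have hR₀ : IsRegularMatrix (fun u v => μ u v - C₀ u v - S u v)
      ((2 * t + 1) * (d + 2) - 2 - (d + 2 - 1)) (2 * t) := by
    have h1 := (hμ.sub (hC₀.isRegularMatrix (by omega))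
      fun u v => by have := hle u v; omega).sub hS fun u v => by have := hle u v; omega
    exact ⟨h1.symm, h1.diag, h1.sum, fun u v => by have := hge u v; omega⟩
  have hdeg : (2 * t + 1) * (d + 2) = 2 * (t * (d + 1)) + 2 * t + d + 2 := by ring
  have hmul : t * h ≤ t * (d + 1) := Nat.mul_le_mul_left _ (by omega)
  have hmul2 : 2 * t * (h - 1) + 2 * t = 2 * (t * h) := by
    obtain ⟨h', rfl⟩ : ∃ h', h = h' + 1 := ⟨h - 1, by omega⟩
    simp only [Nat.add_sub_cancel]; ring
  obtain ⟨P, R, hP, hR, hPR⟩ := IsRegularMatrix.exists_perfect_matchings (h := h) (by omega)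
    (by omega) (2 * t - 1) hR₀ (by omega)
  have hR' : IsRegularMatrix R (2 * (t * (d + 1))) (2 * t) := by
    convert hR using 1
    omega
  obtain ⟨C, A, B, hC, hA, hB, hsum⟩ := hR'.exists_hamilton_decomposition ⟨h, hh⟩ (by omega)
    (by omega)
  have e1 : 2 * t + 1 - 2 = 2 * t - 1 := by omega
  have e2 : (2 * t + 1 + 1) / 2 = t + 1 := by omega
  have e3 : 2 * t + 1 - 1 = t + t := by omega
  rw [e1, e2, e3]
  refine ⟨P, Fin.cons C₀ C, S, Fin.append A B, hP, fun i => ?_, hS, fun i => ?_, fun u v => ?_⟩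
  · refine Fin.cases ?_ (fun i => ?_) i
    · simpa using hC₀
    · simpa using hC i
  · refine Fin.addCases (fun i => ?_) (fun i => ?_) i
    · simpa using hA i
    · rw [Fin.append_right]; exact hB i
  · rw [Fin.sum_univ_succ, Fin.sum_univ_add]
    have h1 := hPR u v
    have h2 := hle u v
    have h3 := hsum u v
    simp only [Finset.sum_add_distrib] at h3
    simp only [Fin.cons_zero, Fin.cons_succ, Fin.append_left, Fin.append_right]
    omega

/-- Removing `r` perfect matchings lowers the degree to `r * (s - 1)` and keeps the multiplicity
bound, so the previous decomposition applies with `s - 1`. -/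
theorem IsRegularMatrix.matrixDecomposesInto_of_add_two [LinearOrder V] {μ : V → V → ℕ} {r s : ℕ}
    (hμ : IsRegularMatrix μ (r * s) r) (hr : 3 ≤ r) (hodd : Odd r) (heven : Even (Fintype.card V))
    (hn : 96 ≤ Fintype.card V) (hs : Fintype.card V + 34 ≤ 2 * s) :
    MatrixDecomposesInto μ (2 * r - 2) ((r + 1) / 2) (s - 2) (r - 1) (s - 3) := by
  obtain ⟨h, hh⟩ := heven
  have hmul : r * h ≤ r * s := Nat.mul_le_mul_left _ (by omega)
  have hmul2 : r * (h - 1) + r = r * h := by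
    obtain ⟨h', rfl⟩ : ∃ h', h = h' + 1 := ⟨h - 1, by omega⟩
    simp only [Nat.add_sub_cancel]; ring
  obtain ⟨P, R, hP, hR, hPR⟩ := IsRegularMatrix.exists_perfect_matchings (h := h) (by omega)
    (by omega) r hμ (by omega)
  have hR' : IsRegularMatrix R (r * (s - 1)) r := by
    rwa [Nat.mul_sub, mul_one]
  obtain ⟨P', C, S, T, hP', hC, hS, hT, hsum⟩ := hR'.matrixDecomposesInto hr hodd ⟨h, hh⟩ hn
    (by omega)
  have e1 : 2 * r - 2 = r + (r - 2) := by omega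
  rw [e1]
  refine ⟨Fin.append P P', C, S, T, fun i => ?_, hC, hS, hT, fun u v => ?_⟩
  · refine Fin.addCases (fun i => ?_) (fun i => ?_) i
    · simpa using hP i
    · simpa using hP' i
  · rw [Fin.sum_univ_add]
    have h1 := hPR u v
    have h2 := hsum u v
    simp only [Fin.append_left, Fin.append_right]
    omega

end MatrixDecomposition

/-! ### From multiplicity matrices back to multigraphs -/

namespace Graph

variable {α β V : Type*}

/-- `M` counts the edges of `H` between the vertices `f u` and `f v`. -/
def HasMatrix (H : Graph α β) (f : V → α) (M : V → V → ℕ) : Prop :=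
  ∀ u v, {e | H.IsLink e (f u) (f v)}.encard = M u v

variable {H : Graph α β} {f : V → α} {M : V → V → ℕ}

theorem HasMatrix.vertexDegree_eq [Fintype V] (hM : H.HasMatrix f M) (hf : Function.Injective f)
    (hrange : Set.range f = H.vertexSet) (hdiag : ∀ u, M u u = 0) (u : V) :
    H.vertexDegree (f u) = ∑ v, M u v := by
  have h1 : H.incidenceSet (f u) = ⋃ v, {e | H.IsLink e (f u) (f v)} := by
    ext e
    simp only [mem_incidenceSet, Set.mem_iUnion, Set.mem_ofPred_eq]
    constructor
    · rintro ⟨y, hy⟩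
      obtain ⟨v, rfl⟩ : y ∈ Set.range f := hrange ▸ hy.right_mem
      exact ⟨v, hy⟩
    · rintro ⟨v, hv⟩
      exact ⟨_, hv⟩
  have h2 : H.loopSet (f u) = ∅ := by
    have := hM u u
    rw [hdiag, Nat.cast_zero, Set.encard_eq_zero] at this
    exact this
  rw [vertexDegree, h1, h2, Set.encard_empty, add_zero, Set.encard_iUnion_of_finite,
    finsum_eq_sum_of_fintype, Nat.cast_sum]
  · exact Finset.sum_congr rfl fun v _ => hM u v
  · intro v w hvw
    rw [Function.onFun, Set.disjoint_left]
    intro e h3 h4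
    exact hvw (hf (IsLink.right_unique h3 h4))

theorem HasMatrix.isRegularOfDegree [Fintype V] (hM : H.HasMatrix f M) (hf : Function.Injective f)
    (hrange : Set.range f = H.vertexSet) {d m : ℕ} (h : IsRegularMatrix M d m) :
    H.IsRegularOfDegree d := by
  intro x hx
  obtain ⟨u, rfl⟩ : x ∈ Set.range f := hrange ▸ hx
  rw [hM.vertexDegree_eq hf hrange h.diag, h.sum]

theorem HasMatrix.eq_of_isLink (hM : H.HasMatrix f M) (hle : ∀ u v, M u v ≤ 1) {u v : V} {e e' : β}
    (he : H.IsLink e (f u) (f v)) (he' : H.IsLink e' (f u) (f v)) : e = e' := by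
  have h1 : {e | H.IsLink e (f u) (f v)}.encard ≤ 1 := by
    rw [hM]; exact_mod_cast hle u v
  exact Set.encard_le_one_iff.1 h1 e e' he he'

theorem HasMatrix.simple [Fintype V] (hM : H.HasMatrix f M) (hrange : Set.range f = H.vertexSet) {d : ℕ}
    (h : IsRegularMatrix M d 1) : H.Simple where
  not_isLoopAt e x he := by
    obtain ⟨u, rfl⟩ : x ∈ Set.range f := hrange ▸ he.vertex_mem
    have h1 := hM u u
    rw [h.diag, Nat.cast_zero, Set.encard_eq_zero] at h1
    exact Set.eq_empty_iff_forall_notMem.1 h1 e he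
  eq_of_isLink e e' x y he he' := by
    obtain ⟨u, rfl⟩ : x ∈ Set.range f := hrange ▸ he.left_mem
    obtain ⟨v, rfl⟩ : y ∈ Set.range f := hrange ▸ he.right_mem
    exact hM.eq_of_isLink h.le he he'

theorem HasMatrix.isCycle [Fintype V] (hM : H.HasMatrix f M) (hf : Function.Injective f)
    (hrange : Set.range f = H.vertexSet) (h : IsHamiltonMatrix M) (hn : 3 ≤ Fintype.card V) :
    H.IsCycle := by
  classical
  have hreg := h.isRegularMatrix hn
  obtain ⟨w, hw, hMw⟩ := h
  set n := Fintype.card V with hnd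
  have : NeZero n := ⟨by omega⟩
  have hval : ∀ i : ZMod n, i.val < n := ZMod.val_lt
  have hsucc : ∀ i : ZMod n, (i + 1).val = (i.val + 1) % n := by
    intro i
    rw [ZMod.val_add, ZMod.val_one_eq_one_mod, Nat.add_mod_mod]
  have hwinj : ∀ i j : ZMod n, w i.val = w j.val → i = j := fun i j hij =>
    ZMod.val_injective n (hw (Set.mem_Iio.2 (hval i)) (Set.mem_Iio.2 (hval j)) hij)
  have hedge : ∀ i : ZMod n, ∃ e, H.IsLink e (f (w i.val)) (f (w (i + 1).val)) := by
    intro i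
    have h1 : M (w i.val) (w (i + 1).val) = 1 := by
      rw [hMw, if_pos]
      exact ⟨i.val, hval i, Or.inl ⟨rfl, by rw [hsucc]⟩⟩
    have h2 := hM (w i.val) (w (i + 1).val)
    rw [h1] at h2
    have h3 : {e | H.IsLink e (f (w i.val)) (f (w (i + 1).val))}.Nonempty := by
      rw [← Set.encard_ne_zero, h2]; simp
    exact h3
  choose e he using hedge
  refine ⟨n, by omega, fun i => f (w i.val), e, fun i j hij => hwinj i j (hf hij), ?_, ?_, ?_, he⟩
  · intro i j hij
    have h1 := he j
    rw [← hij] at h1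
    rcases (he i).eq_and_eq_or_eq_and_eq h1 with ⟨h2, -⟩ | ⟨h2, h3⟩
    · exact hwinj i j (hf h2)
    · have h4 := hwinj _ _ (hf h2)
      have h5 := hwinj _ _ (hf h3)
      rw [h4] at h5
      -- An edge traversed in both directions would force `i = j + 1` and `j = i + 1`, impossible
      -- modulo `n ≥ 3`.
      have h6 : ((2 : ℕ) : ZMod n) = 0 := by
        have : j + 1 + 1 - j = 0 := by rw [h5]; ring
        push_cast
        rw [← this]; ring
      rw [ZMod.natCast_eq_zero_iff] at h6
      exact absurd (Nat.le_of_dvd (by omega) h6) (by omega)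
  · rw [← hrange]
    ext x
    constructor
    · rintro ⟨i, rfl⟩
      exact ⟨_, rfl⟩
    · rintro ⟨u, rfl⟩
      obtain ⟨i, hi, rfl⟩ := SimpleGraph.exists_eq_of_injOn hw u
      exact ⟨(i : ZMod n), by
        have hi' : (i : ZMod n).val = i := by rw [ZMod.val_natCast, Nat.mod_eq_of_lt hi]
        simp only [hi']⟩
  · ext e'
    constructor
    · rintro ⟨i, rfl⟩
      exact (he i).edge_mem
    · intro he'
      obtain ⟨x, y, hxy⟩ := exists_isLink_of_mem_edgeSet he'
      obtain ⟨u, rfl⟩ : x ∈ Set.range f := hrange ▸ hxy.left_mem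
      obtain ⟨v, rfl⟩ : y ∈ Set.range f := hrange ▸ hxy.right_mem
      have h1 := hM u v
      have h2 : M u v ≠ 0 := by
        intro h0
        rw [h0, Nat.cast_zero, Set.encard_eq_zero] at h1
        exact Set.eq_empty_iff_forall_notMem.1 h1 e' hxy
      rw [hMw] at h2
      have h3 := (ite_ne_right_iff.1 h2).1
      obtain ⟨i, hi, h4⟩ := h3
      have hi' : (i : ZMod n).val = i := by rw [ZMod.val_natCast, Nat.mod_eq_of_lt hi]
      have h5 := he (i : ZMod n)
      rw [hsucc, hi'] at h5
      refine ⟨(i : ZMod n), ?_⟩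
      rcases h4 with ⟨rfl, rfl⟩ | ⟨rfl, rfl⟩
      · exact hM.eq_of_isLink hreg.le h5 hxy
      · exact hM.eq_of_isLink hreg.le h5 hxy.symm

/-- A set can be coloured with prescribed sizes of the colour classes. -/
theorem exists_coloring_of_encard {ι : Type*} [Fintype ι] [Nonempty ι] (E : Set β) (m : ι → ℕ)
    (hE : E.encard = ∑ i, m i) :
    ∃ c : β → ι, ∀ i, {e | e ∈ E ∧ c e = i}.encard = m i := by
  classical
  have hfin : E.Finite := Set.finite_of_encard_eq_coe (k := ∑ i, m i) (by rw [hE, Nat.cast_sum])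
  have : Fintype E := hfin.fintype
  have hcard : Fintype.card E = Fintype.card (Σ i, Fin (m i)) := by
    have h1 : (Fintype.card E : ℕ∞) = E.encard := by
      rw [← Set.toFinset_card, ← Set.encard_coe_eq_coe_finsetCard, Set.coe_toFinset]
    rw [hE] at h1
    simp only [Fintype.card_sigma, Fintype.card_fin]
    exact_mod_cast h1
  let φ : E ≃ Σ i, Fin (m i) := Fintype.equivOfCardEq hcard
  refine ⟨fun e => if h : e ∈ E then (φ ⟨e, h⟩).1 else Classical.arbitrary ι, fun i => ?_⟩
  have hset : {e | e ∈ E ∧ (if h : e ∈ E then (φ ⟨e, h⟩).1 else Classical.arbitrary ι) = i} =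
      Set.range fun j : Fin (m i) => ((φ.symm ⟨i, j⟩ : E) : β) := by
    ext e
    constructor
    · rintro ⟨h1, h2⟩
      rw [dif_pos h1] at h2
      subst h2
      exact ⟨(φ ⟨e, h1⟩).2, by simp⟩
    · rintro ⟨j, rfl⟩
      refine ⟨(φ.symm ⟨i, j⟩).2, ?_⟩
      rw [dif_pos (φ.symm ⟨i, j⟩).2]
      simp
  rw [hset, ← Set.image_univ, Function.Injective.encard_image]
  · simp
  · intro j k hjk
    have := φ.symm.injective (Subtype.ext hjk)
    simpa using this

/-- The edges of a multigraph can be coloured so that the colour classes have prescribed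
multiplicity matrices. -/
theorem HasMatrix.exists_coloring [LinearOrder V] {ι : Type*} [Fintype ι] [Nonempty ι]
    (hM : H.HasMatrix f M) (hf : Function.Injective f) (N : ι → V → V → ℕ)
    (hsymm : ∀ i u v, N i u v = N i v u) (hsum : ∀ u v, ∑ i, N i u v = M u v)
    (hdiag : ∀ u, M u u = 0) :
    ∃ c : β → ι, ∀ i, (H.restrict {e | c e = i}).HasMatrix f (N i) := by
  classical
  have hex : ∀ q : V × V, ∃ c : β → ι, ∀ i,
      {e | e ∈ {e | H.IsLink e (f q.1) (f q.2)} ∧ c e = i}.encard = N i q.1 q.2 := fun q =>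
    exists_coloring_of_encard _ (fun i => N i q.1 q.2) (by rw [hM, ← hsum, Nat.cast_sum])
  choose c hc using hex
  -- Each edge has a unique increasing pair of ends, whose colouring decides its colour. The default
  -- value is reached only off the edge set or at loops.
  let col : β → ι := fun e =>
    if h : ∃ q : V × V, q.1 < q.2 ∧ H.IsLink e (f q.1) (f q.2) then c h.choose e
    else Classical.arbitrary ι
  have hcol : ∀ (u v : V) (e : β), u < v → H.IsLink e (f u) (f v) → col e = c (u, v) e := by
    intro u v e huv he
    have h : ∃ q : V × V, q.1 < q.2 ∧ H.IsLink e (f q.1) (f q.2) := ⟨(u, v), huv, he⟩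
    have h1 := h.choose_spec
    have h2 : h.choose = (u, v) := by
      rcases he.eq_and_eq_or_eq_and_eq h1.2 with ⟨h2, h3⟩ | ⟨h2, h3⟩
      · exact Prod.ext (hf h2).symm (hf h3).symm
      · rw [← hf h2, ← hf h3] at h1
        exact absurd huv h1.1.not_gt
    simp only [col, dif_pos h, h2]
  have hlt : ∀ i u v, u < v →
      {e | (H.restrict {e | col e = i}).IsLink e (f u) (f v)}.encard = N i u v := by
    intro i u v huv
    rw [← hc (u, v) i]
    congr 1
    ext e
    simp only [restrict_isLink, Set.mem_ofPred_eq]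
    constructor
    · rintro ⟨h1, h2⟩
      exact ⟨h2, by rw [← hcol u v e huv h2, h1]⟩
    · rintro ⟨h1, h2⟩
      exact ⟨by rw [hcol u v e huv h1, h2], h1⟩
  refine ⟨col, fun i u v => ?_⟩
  rcases lt_trichotomy u v with h | h | h
  · exact hlt i u v h
  · subst h
    have h1 : N i u u = 0 := by
      have h2 : N i u u ≤ ∑ i, N i u u :=
        Finset.single_le_sum (f := fun i => N i u u) (fun _ _ => Nat.zero_le _) (Finset.mem_univ i)
      rw [hsum, hdiag] at h2
      omega
    have h2 := hM u u
    rw [hdiag, Nat.cast_zero, Set.encard_eq_zero] at h2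
    rw [h1, Nat.cast_zero, Set.encard_eq_zero]
    ext e
    simp only [restrict_isLink, Set.mem_ofPred_eq, Set.mem_empty_iff_false, iff_false]
    exact fun h3 => Set.eq_empty_iff_forall_notMem.1 h2 e h3.2
  · rw [hsymm, ← hlt i v u h]
    congr 1
    ext e
    rw [Set.mem_ofPred_eq, Set.mem_ofPred_eq, Graph.isLink_comm]

/-- The parts are the colour classes of an edge colouring whose class sizes on each pair are
prescribed by the matrices, so every edge lies in exactly one of them. -/
theorem HasMatrix.decomposesInto [Fintype V] [LinearOrder V] {p h d₁ q d₂ : ℕ} (hM : H.HasMatrix f M)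
    (hf : Function.Injective f) (hrange : Set.range f = H.vertexSet) (hdiag : ∀ u, M u u = 0)
    (hn : 3 ≤ Fintype.card V) (hdec : MatrixDecomposesInto M p h d₁ q d₂) :
    H.DecomposesInto p h d₁ q d₂ := by
  obtain ⟨P, C, S, T, hP, hC, hS, hT, hsum⟩ := hdec
  obtain ⟨c, hc⟩ := hM.exists_coloring hf
    (Sum.elim P (Sum.elim C (Sum.elim (fun _ : Unit => S) T)))
    (by
      rintro (i | i | i | i) u v
      · exact (hP i).symm u v
      · exact ((hC i).isRegularMatrix hn).symm u v
      · exact hS.symm u v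
      · exact (hT i).symm u v)
    (fun u v => by
      simp only [Fintype.sum_sum_type, Sum.elim_inl, Sum.elim_inr, Finset.univ_unique,
        Finset.sum_singleton]
      exact hsum u v) hdiag
  have hspan : ∀ E : Set β, (H.restrict E).IsSpanningSubgraph H := fun E => ⟨restrict_le, rfl⟩
  refine ⟨fun i => H.restrict {e | c e = .inl i}, fun i => H.restrict {e | c e = .inr (.inl i)},
    H.restrict {e | c e = .inr (.inr (.inl ()))},
    fun i => H.restrict {e | c e = .inr (.inr (.inr i))}, fun i => ⟨hspan _, ?_⟩,
    fun i => ⟨hspan _, ?_⟩, ⟨hspan _, ?_, ?_⟩, fun i => ⟨hspan _, ?_, ?_⟩, ?_⟩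
  · exact (hc (.inl i)).isRegularOfDegree hf hrange (hP i)
  · exact (hc (.inr (.inl i))).isCycle hf hrange (hC i) hn
  · exact (hc (.inr (.inr (.inl ())))).simple hrange hS
  · exact (hc (.inr (.inr (.inl ())))).isRegularOfDegree hf hrange hS
  · exact (hc (.inr (.inr (.inr i)))).simple hrange (hT i)
  · exact (hc (.inr (.inr (.inr i)))).isRegularOfDegree hf hrange (hT i)
  · have heq : Sum.elim (fun i => H.restrict {e | c e = .inl i})
        (Sum.elim (fun i => H.restrict {e | c e = .inr (.inl i)})
          (Sum.elim (fun _ : Unit => H.restrict {e | c e = .inr (.inr (.inl ()))})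
            fun i => H.restrict {e | c e = .inr (.inr (.inr i))})) =
        fun j => H.restrict {e | c e = j} := by
      ext1 j
      rcases j with j | j | j | j <;> rfl
    rw [heq]
    refine ⟨fun j => restrict_le, fun e he => ⟨c e, ⟨he, rfl⟩, fun j hj => ?_⟩⟩
    exact hj.2.symm

end Graph

/-! ### The theorem for multigraphs -/

theorem mainTheorem4 {α β : Type*} (G : Graph α β) (hloop : G.Loopless)
    (n k r : ℕ) (hcard : G.vertexSet.encard = n) (hn : Even n) (hn96 : 96 ≤ n)
    (hreg : G.IsRegularOfDegree k)
    (hmult : G.maxMultiplicity = r) (hr : Odd r) (hr3 : 3 ≤ r) :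
    (∀ s : ℕ, Even s → k = r * s → r * (n / 2 + 16) ≤ k →
      G.DecomposesInto (r - 2) ((r + 1) / 2) (s - 1) (r - 1) (s - 2)) ∧
    (∀ s : ℕ, Odd s → k = r * s → r * (n / 2 + 17) ≤ k →
      G.DecomposesInto (2 * r - 2) ((r + 1) / 2) (s - 2) (r - 1) (s - 3)) := by
  have hfin : G.vertexSet.Finite := Set.finite_of_encard_eq_coe hcard
  have : Fintype G.vertexSet := hfin.fintype
  have hcard' : Fintype.card G.vertexSet = Fintype.card (Fin n) := by
    have h1 : (Fintype.card G.vertexSet : ℕ∞) = G.vertexSet.encard := by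
      rw [← Set.toFinset_card, ← Set.encard_coe_eq_coe_finsetCard, Set.coe_toFinset]
    rw [hcard] at h1
    rw [Fintype.card_fin]
    exact_mod_cast h1
  let φ : Fin n ≃ G.vertexSet := (Fintype.equivOfCardEq hcard').symm
  let f : Fin n → α := fun i => φ i
  have hf : Function.Injective f := Subtype.val_injective.comp φ.injective
  have hrange : Set.range f = G.vertexSet := by
    ext x
    constructor
    · rintro ⟨i, rfl⟩
      exact (φ i).2
    · intro hx
      exact ⟨φ.symm ⟨x, hx⟩, by simp [f]⟩
  have hle : ∀ u v, {e | G.IsLink e (f u) (f v)}.encard ≤ r := by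
    intro u v
    by_cases huv : u = v
    · subst huv
      have : {e | G.IsLink e (f u) (f u)} = ∅ := by
        ext e
        simp
      rw [this]; simp
    · rw [← hmult, Graph.maxMultiplicity]
      exact le_iSup_of_le (f u) (le_iSup_of_le (f v) (le_iSup_of_le (fun h => huv (hf h)) le_rfl))
  -- The bound by `r` makes every multiplicity finite, so a natural number matrix exists.
  have hex : ∀ u v, ∃ m : ℕ, {e | G.IsLink e (f u) (f v)}.encard = m := fun u v =>
    ⟨_, (ENat.natCast_toNat (ne_top_of_le_ne_top (ENat.natCast_ne_top r) (hle u v))).symm⟩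
  choose M hM using hex
  have hM : G.HasMatrix f M := hM
  have hdiag : ∀ u, M u u = 0 := by
    intro u
    have h1 := hM u u
    have h2 : {e | G.IsLink e (f u) (f u)} = ∅ := by
      ext e
      simp
    rw [h2, Set.encard_empty] at h1
    exact_mod_cast h1.symm
  have hMreg : IsRegularMatrix M k r := by
    refine ⟨fun u v => ?_, hdiag, fun u => ?_, fun u v => ?_⟩
    · have h1 := hM u v
      simp only [Graph.isLink_comm (x := f u)] at h1
      rw [hM v u] at h1
      exact_mod_cast h1.symm
    · have h1 := hM.vertexDegree_eq hf hrange hdiag u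
      rw [hreg _ (φ u).2] at h1
      exact_mod_cast h1.symm
    · have h1 := hle u v
      rw [hM] at h1
      exact_mod_cast h1
  have hc : Fintype.card (Fin n) = n := Fintype.card_fin n
  refine ⟨fun s _ hk hs => ?_, fun s _ hk hs => ?_⟩ <;> subst hk
  -- Cancelling `r` gives `n / 2 + 16 ≤ s`, which is `n + 32 ≤ 2 * s` because `n` is even.
  · have hs' := Nat.le_of_mul_le_mul_left hs (by omega)
    obtain ⟨h, hh⟩ := hn
    exact hM.decomposesInto hf hrange hdiag (by omega)
      (hMreg.matrixDecomposesInto hr3 hr ⟨h, by omega⟩ (by omega) (by omega))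
  · have hs' := Nat.le_of_mul_le_mul_left hs (by omega)
    obtain ⟨h, hh⟩ := hn
    exact hM.decomposesInto hf hrange hdiag (by omega)
      (hMreg.matrixDecomposesInto_of_add_two hr3 hr ⟨h, by omega⟩ (by omega) (by omega))
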